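/- For $n\ge 1$ and $\beta\in\mathbb R$, let $\mathbb P_n^{(\beta)}$ be the Curie--Weiss law of $n$ spins: the law of $n$ i.i.d. symmetric $\{\pm1\}$-valued signs $X_1,\dots,X_n$, biased by the density $e^{\frac{\beta}{2n}S_n^2}/\mathbb E\big[e^{\frac{\beta}{2n}S_n^2}\big]$, where $S_n=X_1+\dots+X_n$. Let $M_n^{(\beta)}=\sum_{k=1}^n X_k^{(\beta)}$ with $(X_k^{(\beta)})_{k\le n}\sim\mathbb P_n^{(\beta)}$. For $\beta>0$ let $\widetilde\nu_{n,\beta}$ be the probability measure on $(0,1)$ with density $$\frac1{\mathcal Z_{n,\beta}}\exp\Big(-\tfrac{n}{2\beta}\operatorname{artanh}(2p-1)^2-\big(\tfrac n2+1\big)\log\big(1-(2p-1)^2\big)\Big).$$ If $U_1,\dots,U_n$ are i.i.d. uniform on $[0,1]$ and independent of $\widetilde V_{n,\beta}\sim\widetilde\nu_{n,\beta}$, then $\big(2\cdot\mathbf 1_{\{U_k<\widetilde V_{n,\beta}\}}-1\big)_{k\le n}$ has law $\mathbb P_n^{(\beta)}$; in this coupling $M_n^{(\beta)}=\sum_{k=1}^n\big(2\cdot\mathbf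 1_{\{U_k<\widetilde V_{n,\beta}\}}-1\big)$, and one sets $T_n^{(\beta)}:=2\widetilde V_{n,\beta}-1$. Let $\gamma\in\mathbb R$ and $\beta_n=1-\gamma/\sqrt n$ (which is positive for $n$ large). Let $F_\gamma$ be a random variable with law $$\mathbb P(F_\gamma\in dx)=\frac{1}{\mathcal Z_{F_\gamma}}e^{-\frac{x^4}{12}-\gamma\frac{x^2}{2}}\,dx,\qquad \mathcal Z_{F_\gamma}=\int_{\mathbb R}e^{-\frac{x^4}{12}-\gamma\frac{x^2}{2}}\,dx<\infty .$$ Then, as $n\to\infty$, $$\frac{M_n^{(\beta_n)}}{n^{3/4}}\to F_\gamma\quad\text{in law},$$ and, in the above coupling, $$\Big(n^{1/4}\Big(\frac{M_n^{(\beta_n)}}{n^{3/4}}-n^{1/4}T_n^{(\beta_n)}\Big),\;n^{1/4}T_n^{(\beta_n)}\Big)\to(G,F_\gamma)\quad\text{in law},$$ where $G\sim\mathcal N(0,1)$ is independent of $F_\gamma$. In particular, for $\gamma=0$ (that is, $\beta_n=1$ for all $n$) both convergences hold with $F:=F_0$, whose law is $\frac1{\mathcal Z_F}e^{-x^4/12}dx$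 with $\mathcal Z_F=\int_{\mathbb R}e^{-x^4/12}dx=3^{1/4}\,2^{-1/2}\,\Gamma(1/4)$. Moreover $F$ has the same law as $B\,\big(12\,\boldsymbol\gamma(1/4)\big)^{1/4}$, where $B$ is uniform on $\{-1,1\}$ and independent of $\boldsymbol\gamma(1/4)$, which has the Gamma law of shape $1/4$ and rate $1$, with density $\Gamma(1/4)^{-1}x^{-3/4}e^{-x}\mathbf 1_{\{x>0\}}$. -/

import Mathlib

open MeasureTheory ProbabilityTheory Filter

noncomputable section

namespace CurieWeiss

/-- The symmetric Bernoulli law on `{-1, 1}`. -/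
def spinLaw : Measure ℝ :=
  bernoulliMeasure (1 : ℝ) (-1) ⟨1 / 2, by norm_num, by norm_num⟩

/-- The Curie-Weiss law of `n` spins at inverse temperature `β`: the law of `n` i.i.d. symmetric
signs, biased by `exp (β S² / (2 n))`, where `S` is the sum of the signs. -/
def curieWeissMeasure (n : ℕ) (β : ℝ) : Measure (Fin n → ℝ) :=
  (Measure.pi fun _ : Fin n => spinLaw).tilted fun x => β / (2 * n) * (∑ k, x k) ^ 2

/-- The De Finetti measure of the Curie-Weiss model: the probability measure on `(0, 1)` with
density proportional to `exp (-(n / 2β) artanh(2p - 1)² - (n / 2 + 1) log (1 - (2p - 1)²))`. -/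
def deFinettiMeasure (n : ℕ) (β : ℝ) : Measure ℝ :=
  (volume.restrict (Set.Ioo (0 : ℝ) 1)).tilted fun p =>
    -(n / (2 * β)) * Real.artanh (2 * p - 1) ^ 2
      - (n / 2 + 1) * Real.log (1 - (2 * p - 1) ^ 2)

/-- The law on `ℝ` with density proportional to `exp (-x⁴ / 12 - γ x² / 2)`. -/
def limitLaw (γ : ℝ) : Measure ℝ :=
  (volume : Measure ℝ).tilted fun x => -(x ^ 4 / 12) - γ * (x ^ 2 / 2)

/-- The randomised spin `2 · 1_{u < v} - 1`. -/
def coupledSpin (u v : ℝ) : ℝ :=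
  2 * (if u < v then 1 else 0) - 1

/-- `U₁, …, Uₙ` are i.i.d. uniform on `[0, 1]` and independent of `V`, whose law is the De Finetti
measure. -/
structure IsUniformCoupling {Ω : Type*} [MeasurableSpace Ω] (n : ℕ) (β : ℝ)
    (U : Fin n → Ω → ℝ) (V : Ω → ℝ) (P : Measure Ω) : Prop where
  uniform : ∀ k, HasLaw (U k) (volume.restrict (Set.Icc (0 : ℝ) 1)) P
  iIndep : iIndepFun U P
  deFinetti : HasLaw V (deFinettiMeasure n β) P
  indep : IndepFun (fun ω k => U k ω) V P

end CurieWeiss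

end

/-
The Gaussian linearisation of the square, `exp (b s² / (2n)) ∝ ∫ exp (-n y² / (2b) + s y) dy`, turns
the Curie-Weiss law into a mixture of i.i.d. laws: given a random field `y` with density
proportional to `exp (-n y² / (2b) + n log (cosh y))`, the spins are independent with mean `tanh y`,
and `p = (1 + tanh y) / 2` carries the law of the field to the De Finetti measure.

Put `y = x / n^(1/4)`. Since `log (cosh y) = y² / 2 - y⁴ / 12 + o(y⁴)`, the quadratic terms cancel
at `b = 1`, the exponent tends to `-x⁴ / 12 - γ x² / 2`, and dominated convergence gives the quartic
limit of `n^(1/4) tanh y`. As `tanh y → 0`, the spins have conditional variance close to `1`, so a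
central limit theorem for the triangular array of centred spins contributes an independent
standard Gaussian fluctuation to the joint characteristic function.
-/

noncomputable section

namespace CurieWeiss

open Real Topology

lemma le_of_hasDerivAt_le {f g f' g' : ℝ → ℝ} {a x : ℝ} (hf : ∀ y, HasDerivAt f (f' y) y)
    (hg : ∀ y, HasDerivAt g (g' y) y) (ha : f a ≤ g a) (h : ∀ y, a ≤ y → f' y ≤ g' y)
    (hx : a ≤ x) : f x ≤ g x :=
  image_le_of_deriv_right_le_deriv_boundary (b := x)
    (fun y _ => (hf y).continuousAt.continuousWithinAt) (fun y _ => (hf y).hasDerivWithinAt) ha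
    (fun y _ => (hg y).continuousAt.continuousWithinAt) (fun y _ => (hg y).hasDerivWithinAt)
    (fun y hy => h y hy.1) ⟨hx, le_rfl⟩

lemma one_sub_tanh_sq (x : ℝ) : 1 - tanh x ^ 2 = (cosh x ^ 2)⁻¹ := by
  have hc : cosh x ≠ 0 := (cosh_pos x).ne'
  rw [tanh_eq_sinh_div_cosh]
  field_simp
  exact cosh_sq_sub_sinh_sq x

lemma hasDerivAt_tanh (x : ℝ) : HasDerivAt tanh (1 - tanh x ^ 2) x := by
  have hc : cosh x ≠ 0 := (cosh_pos x).ne'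
  have h := (hasDerivAt_sinh x).fun_div (hasDerivAt_cosh x) hc
  simp only [← tanh_eq_sinh_div_cosh] at h
  refine h.congr_deriv ?_
  rw [one_sub_tanh_sq, ← sq, ← sq, cosh_sq_sub_sinh_sq, one_div]

@[fun_prop]
lemma continuous_tanh : Continuous tanh :=
  continuous_iff_continuousAt.2 fun x => (hasDerivAt_tanh x).continuousAt

lemma hasDerivAt_log_cosh (x : ℝ) : HasDerivAt (fun y => log (cosh y)) (tanh x) x := by
  simpa only [tanh_eq_sinh_div_cosh] using (hasDerivAt_cosh x).log (cosh_pos x).ne'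

lemma tanh_le_self {x : ℝ} (hx : 0 ≤ x) : tanh x ≤ x :=
  le_of_hasDerivAt_le hasDerivAt_tanh hasDerivAt_id tanh_zero.le
    (fun y _ => sub_le_self 1 (sq_nonneg (tanh y))) hx

lemma sq_div_one_add_sq_le_tanh_sq {x : ℝ} (hx : 0 ≤ x) : x ^ 2 / (1 + x ^ 2) ≤ tanh x ^ 2 := by
  have h : x ^ 2 ≤ sinh x ^ 2 := pow_le_pow_left₀ hx (self_le_sinh_iff.2 hx) 2
  rw [tanh_eq_sinh_div_cosh, div_pow, cosh_sq, div_le_div_iff₀ (by positivity) (by positivity)]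
  linarith

lemma self_sub_tanh_le {x : ℝ} (hx : 0 ≤ x) : x - tanh x ≤ x ^ 3 / 3 := by
  refine le_of_hasDerivAt_le (f := fun y => y - tanh y) (g := fun y => y ^ 3 / 3)
    (fun y => (hasDerivAt_id y).sub (hasDerivAt_tanh y))
    (fun y => (hasDerivAt_pow 3 y).div_const 3) (by simp) (fun y hy => ?_) hx
  have h0 : 0 ≤ tanh y := by
    rw [tanh_eq_sinh_div_cosh]
    exact div_nonneg (sinh_nonneg_iff.2 hy) (cosh_pos y).le
  have h : tanh y ^ 2 ≤ y ^ 2 := pow_le_pow_left₀ h0 (tanh_le_self hy) 2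
  norm_num
  linarith

lemma le_self_sub_tanh {x : ℝ} (hx : 0 ≤ x) : x ^ 3 / (1 + x ^ 2) / 3 ≤ x - tanh x := by
  have hden (y : ℝ) : HasDerivAt (fun z : ℝ => 1 + z ^ 2) (2 * y) y := by
    simpa using (hasDerivAt_pow 2 y).const_add 1
  have hne (y : ℝ) : 1 + y ^ 2 ≠ 0 := by positivity
  refine le_of_hasDerivAt_le (f := fun y => y ^ 3 / (1 + y ^ 2) / 3) (g := fun y => y - tanh y)
    (fun y => ((hasDerivAt_pow 3 y).fun_div (hden y) (hne y)).div_const 3)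
    (fun y => (hasDerivAt_id y).sub (hasDerivAt_tanh y)) (by simp) (fun y hy => ?_) hx
  calc _ = y ^ 2 / (1 + y ^ 2) * ((3 + y ^ 2) / (3 * (1 + y ^ 2))) := by
        have := hne y
        norm_num
        field_simp
        ring
    _ ≤ y ^ 2 / (1 + y ^ 2) * 1 := by
        gcongr
        rw [div_le_one (by positivity)]
        nlinarith [sq_nonneg y]
    _ ≤ 1 - (1 - tanh y ^ 2) := by linarith [sq_div_one_add_sq_le_tanh_sq hy]

/-- The defect `x² / 2 - log cosh x` of the cumulant generating function of a symmetric sign from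
that of a standard Gaussian; it is of order `x⁴ / 12` at the origin. -/
def logCoshDefect (x : ℝ) : ℝ := x ^ 2 / 2 - log (cosh x)

lemma logCoshDefect_zero : logCoshDefect 0 = 0 := by simp [logCoshDefect]

lemma logCoshDefect_abs (x : ℝ) : logCoshDefect |x| = logCoshDefect x := by
  simp [logCoshDefect]

lemma hasDerivAt_logCoshDefect (x : ℝ) : HasDerivAt logCoshDefect (x - tanh x) x :=
  (((hasDerivAt_pow 2 x).div_const 2).fun_sub (hasDerivAt_log_cosh x)).congr_deriv (by simp)

lemma logCoshDefect_le (x : ℝ) : logCoshDefect x ≤ x ^ 4 / 12 := by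
  rw [← logCoshDefect_abs, ← Even.pow_abs (show Even 4 by decide)]
  refine le_of_hasDerivAt_le (g := fun y => y ^ 4 / 12) hasDerivAt_logCoshDefect
    (fun y => (hasDerivAt_pow 4 y).div_const 12) (by simp [logCoshDefect_zero]) (fun y hy => ?_)
    (abs_nonneg x)
  norm_num
  linarith [self_sub_tanh_le hy]

lemma le_logCoshDefect (x : ℝ) : x ^ 4 / (1 + x ^ 2) / 12 ≤ logCoshDefect x := by
  rw [← logCoshDefect_abs, ← Even.pow_abs (show Even 4 by decide), ← sq_abs x]
  have hden (y : ℝ) : HasDerivAt (fun z : ℝ => 1 + z ^ 2) (2 * y) y := by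
    simpa using (hasDerivAt_pow 2 y).const_add 1
  have hne (y : ℝ) : 1 + y ^ 2 ≠ 0 := by positivity
  refine le_of_hasDerivAt_le (f := fun y => y ^ 4 / (1 + y ^ 2) / 12)
    (fun y => ((hasDerivAt_pow 4 y).fun_div (hden y) (hne y)).div_const 12)
    hasDerivAt_logCoshDefect (by simp [logCoshDefect_zero]) (fun y hy => ?_) (abs_nonneg x)
  calc _ = y ^ 3 / (1 + y ^ 2) / 3 * ((2 + y ^ 2) / (2 * (1 + y ^ 2))) := by
        have := hne y
        norm_num
        field_simp
        ring
    _ ≤ y ^ 3 / (1 + y ^ 2) / 3 * 1 := by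
        gcongr
        rw [div_le_one (by positivity)]
        nlinarith [sq_nonneg y]
    _ ≤ y - tanh y := by linarith [le_self_sub_tanh hy]

lemma map_tilted_restrict {s : Set ℝ} {φ φ' f g : ℝ → ℝ} {C : ℝ} (hs : MeasurableSet s)
    (hφ : Measurable φ) (hinj : Set.InjOn φ s) (hφ' : ∀ x ∈ s, HasDerivWithinAt φ (φ' x) s x)
    (hC : 0 < C) (h : ∀ x ∈ s, |φ' x| * exp (g (φ x)) = C * exp (f x)) :
    ((volume.restrict s).tilted f).map φ = (volume.restrict (φ '' s)).tilted g := by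
  have hnorm : ∫ y in φ '' s, exp (g y) = C * ∫ x in s, exp (f x) := by
    rw [integral_image_eq_integral_abs_deriv_smul hs hφ' hinj, ← integral_const_mul]
    exact setIntegral_congr_fun hs h
  ext t ht
  have ht' : MeasurableSet (s ∩ φ ⁻¹' t) := hs.inter (hφ ht)
  rw [Measure.map_apply hφ ht, tilted_apply' _ _ (hφ ht), tilted_apply' _ _ ht,
    Measure.restrict_restrict (hφ ht), Measure.restrict_restrict ht, Set.inter_comm t,
    ← Set.image_inter_preimage, Set.inter_comm (φ ⁻¹' t),
    lintegral_image_eq_lintegral_abs_deriv_mul ht'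
      (fun x hx => (hφ' x hx.1).mono Set.inter_subset_left) (hinj.mono Set.inter_subset_left),
    hnorm]
  refine setLIntegral_congr_fun ht' fun x hx => ?_
  rw [← ENNReal.ofReal_mul (abs_nonneg _), ← mul_div_assoc, h x hx.1,
    mul_div_mul_left _ _ hC.ne']

lemma map_tilted_volume {φ φ' f g : ℝ → ℝ} {C : ℝ} (hφ' : ∀ x, HasDerivAt φ (φ' x) x)
    (hinj : φ.Injective) (hC : 0 < C) (h : ∀ x, |φ' x| * exp (g (φ x)) = C * exp (f x)) :
    (volume.tilted f).map φ = (volume.restrict (Set.range φ)).tilted g := by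
  have hφ : Measurable φ :=
    (continuous_iff_continuousAt.2 fun x => (hφ' x).continuousAt).measurable
  simpa only [Measure.restrict_univ, Set.image_univ] using
    map_tilted_restrict MeasurableSet.univ hφ hinj.injOn
      (fun x _ => (hφ' x).hasDerivWithinAt) hC fun x _ => h x

lemma integral_tilted_comp_div {E : Type*} [NormedAddCommGroup E] [NormedSpace ℝ E]
    (f : ℝ → ℝ) (g : ℝ → E) {r : ℝ} (hr : r ≠ 0) :
    ∫ x, g (x / r) ∂(volume : Measure ℝ).tilted (fun x => f (x / r))
      = ∫ y, g y ∂(volume : Measure ℝ).tilted f := by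
  rw [integral_tilted, integral_tilted, Measure.integral_comp_div (fun y => exp (f y)),
    Measure.integral_comp_div (fun y => (exp (f y) / (|r| • ∫ y, exp (f y))) • g y),
    ← integral_smul]
  refine integral_congr_ae (Eventually.of_forall fun y => ?_)
  have hr' : |r| ≠ 0 := abs_ne_zero.2 hr
  simp only [smul_smul, smul_eq_mul]
  congr 1
  field_simp

lemma tendsto_integral_tilted {α E : Type*} [MeasurableSpace α] {μ : Measure α} [NeZero μ]
    [NormedAddCommGroup E] [NormedSpace ℝ E] {f : ℕ → α → ℝ} {f₀ b : α → ℝ} {Φ : ℕ → α → E}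
    {Φ₀ : α → E} {C : ℝ} (hf : ∀ n, AEMeasurable (f n) μ)
    (hΦ : ∀ n, AEStronglyMeasurable (Φ n) μ) (hb : Integrable (fun x => exp (b x)) μ)
    (hfb : ∀ᶠ n in atTop, ∀ x, f n x ≤ b x) (hΦC : ∀ᶠ n in atTop, ∀ x, ‖Φ n x‖ ≤ C)
    (hf₀ : ∀ x, Tendsto (fun n => f n x) atTop (𝓝 (f₀ x)))
    (hΦ₀ : ∀ x, Tendsto (fun n => Φ n x) atTop (𝓝 (Φ₀ x))) :
    Tendsto (fun n => ∫ x, Φ n x ∂μ.tilted (f n)) atTop (𝓝 (∫ x, Φ₀ x ∂μ.tilted f₀)) := by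
  have hexp (x : α) : Tendsto (fun n => exp (f n x)) atTop (𝓝 (exp (f₀ x))) :=
    (continuous_exp.tendsto _).comp (hf₀ x)
  have hexpm (n : ℕ) : AEStronglyMeasurable (fun x => exp (f n x)) μ :=
    (measurable_exp.comp_aemeasurable (hf n)).aestronglyMeasurable
  have hexpb : ∀ᶠ n in atTop, ∀ x, ‖exp (f n x)‖ ≤ exp (b x) := by
    filter_upwards [hfb] with n hn x
    rw [norm_of_nonneg (exp_pos _).le]
    exact exp_le_exp.2 (hn x)
  have hden : Tendsto (fun n => ∫ x, exp (f n x) ∂μ) atTop (𝓝 (∫ x, exp (f₀ x) ∂μ)) :=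
    tendsto_integral_filter_of_dominated_convergence _ (Eventually.of_forall hexpm)
      (hexpb.mono fun n hn => Eventually.of_forall hn) hb (Eventually.of_forall hexp)
  have hnum : Tendsto (fun n => ∫ x, exp (f n x) • Φ n x ∂μ) atTop
      (𝓝 (∫ x, exp (f₀ x) • Φ₀ x ∂μ)) := by
    refine tendsto_integral_filter_of_dominated_convergence (fun x => exp (b x) * C)
      (Eventually.of_forall fun n => (hexpm n).smul (hΦ n)) ?_ (hb.mul_const C)
      (Eventually.of_forall fun x => (hexp x).smul (hΦ₀ x))
    filter_upwards [hexpb, hΦC] with n hn hn'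
    refine Eventually.of_forall fun x => ?_
    rw [norm_smul]
    exact mul_le_mul (hn x) (hn' x) (norm_nonneg _) (exp_pos _).le
  have hint : Integrable (fun x => exp (f₀ x)) μ := by
    refine hb.mono' (aestronglyMeasurable_of_tendsto_ae atTop hexpm (Eventually.of_forall hexp))
      (Eventually.of_forall fun x => ?_)
    exact le_of_tendsto (hexp x).norm (hexpb.mono fun n hn => hn x)
  simp_rw [integral_tilted, div_eq_inv_mul, mul_smul, integral_smul]
  exact (hden.inv₀ (integral_exp_pos hint).ne').smul hnum

lemma pi_tilted {ι : Type*} [Fintype ι] {α : ι → Type*} [∀ i, MeasurableSpace (α i)]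
    (μ : ∀ i, Measure (α i)) [∀ i, SigmaFinite (μ i)] (f : ∀ i, α i → ℝ) :
    Measure.pi (fun i => (μ i).tilted (f i))
      = (Measure.pi μ).tilted fun x => ∑ i, f i (x i) := by
  refine Measure.pi_eq fun s hs => ?_
  have hprod (x : ∀ i, α i) : (Set.univ.pi s).indicator
      (fun x => exp (∑ i, f i (x i)) / ∫ x, exp (∑ i, f i (x i)) ∂Measure.pi μ) x
      = ∏ i, (s i).indicator (fun x => exp (f i x) / ∫ x, exp (f i x) ∂μ i) (x i) := by
    simp_rw [exp_sum, integral_fintype_prod_eq_prod (fun i x => exp (f i x)),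
      ← Finset.prod_div_distrib]
    by_cases hx : x ∈ Set.univ.pi s
    · rw [Set.indicator_of_mem hx]
      exact Finset.prod_congr rfl fun i _ => by rw [Set.indicator_of_mem (hx i trivial)]
    · obtain ⟨i, hi⟩ : ∃ i, x i ∉ s i := by simpa using hx
      rw [Set.indicator_of_notMem hx]
      exact (Finset.prod_eq_zero (Finset.mem_univ i) (Set.indicator_of_notMem hi _)).symm
  rw [tilted_apply_eq_ofReal_integral' _ (MeasurableSet.univ_pi hs),
    ← integral_indicator (MeasurableSet.univ_pi hs), integral_congr_ae (ae_of_all _ hprod),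
    integral_fintype_prod_eq_prod
      (fun i => (s i).indicator fun x => exp (f i x) / ∫ x, exp (f i x) ∂μ i)]
  simp_rw [integral_indicator (hs _)]
  rw [ENNReal.ofReal_prod_of_nonneg fun i _ => integral_nonneg fun x => by positivity]
  exact Finset.prod_congr rfl fun i _ => (tilted_apply_eq_ofReal_integral' _ (hs i)).symm

section HubbardStratonovich

variable {Ω : Type*} [MeasurableSpace Ω] {μ : Measure Ω} {S : Ω → ℝ} {a : ℝ}

lemma exp_neg_mul_sq_add_mul (ha : a ≠ 0) (s y : ℝ) :
    exp (-a * y ^ 2 + y * s) = exp (s ^ 2 / (4 * a)) * exp (-a * (y - s / (2 * a)) ^ 2) := by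
  rw [← exp_add]
  congr 1
  field_simp
  ring

lemma integrable_exp_neg_mul_sq_add_mul (ha : 0 < a) (s : ℝ) :
    Integrable fun y => exp (-a * y ^ 2 + y * s) := by
  simp_rw [exp_neg_mul_sq_add_mul ha.ne']
  exact ((integrable_exp_neg_mul_sq ha).comp_sub_right _).const_mul _

lemma integral_exp_neg_mul_sq_add_mul (ha : 0 < a) (s : ℝ) :
    ∫ y, exp (-a * y ^ 2 + y * s) = √(π / a) * exp (s ^ 2 / (4 * a)) := by
  simp_rw [exp_neg_mul_sq_add_mul ha.ne']
  rw [integral_const_mul, integral_sub_right_eq_self (fun y => exp (-a * y ^ 2)),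
    integral_gaussian, mul_comm]

lemma integrable_exp_mul_of_integrable_exp_sq (ha : 0 < a) (hS : AEMeasurable S μ)
    (hint : Integrable (fun x => exp (S x ^ 2 / (4 * a))) μ) (y : ℝ) :
    Integrable (fun x => exp (y * S x)) μ := by
  refine (hint.const_mul (exp (a * y ^ 2))).mono' (by fun_prop) (ae_of_all _ fun x => ?_)
  rw [norm_of_nonneg (exp_pos _).le, ← exp_add, exp_le_exp]
  have h : a * y ^ 2 + S x ^ 2 / (4 * a) - y * S x = (2 * a * y - S x) ^ 2 / (4 * a) := by
    field_simp
    ring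
  have : 0 ≤ (2 * a * y - S x) ^ 2 / (4 * a) := by positivity
  linarith

lemma integrable_prod_exp_neg_mul_sq_add_mul [SFinite μ] (ha : 0 < a) (hS : Measurable S)
    (hint : Integrable (fun x => exp (S x ^ 2 / (4 * a))) μ) :
    Integrable (fun q : ℝ × Ω => exp (-a * q.1 ^ 2 + q.1 * S q.2)) (volume.prod μ) := by
  refine (integrable_prod_iff' (by fun_prop)).2
    ⟨ae_of_all _ fun x => integrable_exp_neg_mul_sq_add_mul ha (S x), ?_⟩
  simp_rw [norm_of_nonneg (exp_pos _).le, integral_exp_neg_mul_sq_add_mul ha]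
  exact hint.const_mul _

lemma exp_neg_mul_sq_add_cgf [NeZero μ] (ha : 0 < a) (hS : AEMeasurable S μ)
    (hint : Integrable (fun x => exp (S x ^ 2 / (4 * a))) μ) (y : ℝ) :
    exp (-a * y ^ 2 + cgf S μ y) = ∫ x, exp (-a * y ^ 2 + y * S x) ∂μ := by
  have hy := integrable_exp_mul_of_integrable_exp_sq ha hS hint y
  simp_rw [exp_add, integral_const_mul, exp_cgf hy, mgf]

lemma integrable_exp_neg_mul_sq_add_cgf [SFinite μ] [NeZero μ] (ha : 0 < a) (hS : Measurable S)
    (hint : Integrable (fun x => exp (S x ^ 2 / (4 * a))) μ) :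
    Integrable fun y => exp (-a * y ^ 2 + cgf S μ y) := by
  simp_rw [exp_neg_mul_sq_add_cgf ha hS.aemeasurable hint]
  exact (integrable_prod_exp_neg_mul_sq_add_mul ha hS hint).integral_prod_left

lemma integral_exp_neg_mul_sq_add_cgf [SFinite μ] [NeZero μ] (ha : 0 < a) (hS : Measurable S)
    (hint : Integrable (fun x => exp (S x ^ 2 / (4 * a))) μ) :
    ∫ y, exp (-a * y ^ 2 + cgf S μ y) = √(π / a) * ∫ x, exp (S x ^ 2 / (4 * a)) ∂μ := by
  simp_rw [exp_neg_mul_sq_add_cgf ha hS.aemeasurable hint]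
  rw [integral_integral_swap (integrable_prod_exp_neg_mul_sq_add_mul ha hS hint)]
  simp_rw [integral_exp_neg_mul_sq_add_mul ha, integral_const_mul]

lemma lintegral_tilted_mul_apply_eq_tilted_sq_apply [SFinite μ] [NeZero μ] (ha : 0 < a)
    (hS : Measurable S) (hint : Integrable (fun x => exp (S x ^ 2 / (4 * a))) μ) {s : Set Ω}
    (hs : MeasurableSet s) :
    ∫⁻ y, (μ.tilted fun x => y * S x) s ∂volume.tilted (fun y => -a * y ^ 2 + cgf S μ y)
      = (μ.tilted fun x => S x ^ 2 / (4 * a)) s := by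
  set Z := ∫ y, exp (-a * y ^ 2 + cgf S μ y) with hZ
  have hZ0 : 0 < Z := integral_exp_pos (integrable_exp_neg_mul_sq_add_cgf ha hS hint)
  have hmeas : Measurable fun q : ℝ × Ω =>
      ENNReal.ofReal (Z⁻¹ * exp (-a * q.1 ^ 2 + q.1 * S q.2)) := by fun_prop
  have hdensity (y : ℝ) :
      ENNReal.ofReal (exp (-a * y ^ 2 + cgf S μ y) / Z) * (μ.tilted fun x => y * S x) s
      = ∫⁻ x in s, ENNReal.ofReal (Z⁻¹ * exp (-a * y ^ 2 + y * S x)) ∂μ := by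
    have hy := integrable_exp_mul_of_integrable_exp_sq ha hS.aemeasurable hint y
    have hmgf : 0 < mgf S μ y := mgf_pos' NeZero.out hy
    rw [tilted_apply' _ _ hs, ← lintegral_const_mul _ (by fun_prop)]
    refine lintegral_congr fun x => ?_
    rw [← ENNReal.ofReal_mul (by positivity), exp_add, exp_cgf hy, exp_add, ← mgf]
    congr 1
    field_simp
  have hgauss (x : Ω) : ∫⁻ y, ENNReal.ofReal (Z⁻¹ * exp (-a * y ^ 2 + y * S x))
      = ENNReal.ofReal (exp (S x ^ 2 / (4 * a)) / ∫ x, exp (S x ^ 2 / (4 * a)) ∂μ) := by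
    rw [← ofReal_integral_eq_lintegral_ofReal
      ((integrable_exp_neg_mul_sq_add_mul ha (S x)).const_mul _)
      (ae_of_all _ fun y => by positivity), integral_const_mul,
      integral_exp_neg_mul_sq_add_mul ha, hZ, integral_exp_neg_mul_sq_add_cgf ha hS hint]
    have : √(π / a) ≠ 0 := by positivity
    congr 1
    field_simp
  rw [lintegral_tilted]
  simp_rw [← hZ, hdensity]
  rw [lintegral_lintegral_swap hmeas.aemeasurable, tilted_apply' _ _ hs]
  simp_rw [hgauss]

end HubbardStratonovich

/-- The law on `{-1, 1}` of a sign that is positive with probability `p`. -/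
def signLaw (p : unitInterval) : Measure ℝ := bernoulliMeasure 1 (-1) p

instance (p : unitInterval) : IsProbabilityMeasure (signLaw p) := by
  unfold signLaw
  infer_instance

lemma integral_signLaw {E : Type*} [NormedAddCommGroup E] [NormedSpace ℝ E] [CompleteSpace E]
    (p : unitInterval) (f : ℝ → E) :
    ∫ x, f x ∂signLaw p = (p : ℝ) • f 1 + (1 - p : ℝ) • f (-1) :=
  integral_bernoulliMeasure _ _ _ _

lemma ae_abs_eq_one_signLaw (p : unitInterval) : ∀ᵐ x ∂signLaw p, |x| = 1 := by
  rw [signLaw, bernoulliMeasure_def, ae_add_measure_iff]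
  constructor <;> refine Measure.ae_smul_measure ?_ _ <;> simp [ae_dirac_eq]

lemma spinLaw_eq_signLaw : spinLaw = signLaw ⟨1 / 2, by norm_num, by norm_num⟩ := rfl

instance : IsProbabilityMeasure spinLaw := by
  rw [spinLaw_eq_signLaw]
  infer_instance

lemma integral_spinLaw {E : Type*} [NormedAddCommGroup E] [NormedSpace ℝ E] [CompleteSpace E]
    (f : ℝ → E) : ∫ x, f x ∂spinLaw = (1 / 2 : ℝ) • f 1 + (1 / 2 : ℝ) • f (-1) := by
  rw [spinLaw_eq_signLaw, integral_signLaw]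
  norm_num

lemma integral_exp_mul_spinLaw (y : ℝ) : ∫ x, exp (y * x) ∂spinLaw = cosh y := by
  rw [integral_spinLaw, cosh_eq]
  simp only [smul_eq_mul, mul_one, mul_neg]
  ring

/-- The probability of a positive spin in the external field `y`, namely
`exp y / (exp y + exp (-y))`. -/
def spinProb (y : ℝ) : unitInterval :=
  ⟨(1 + tanh y) / 2, by linarith [neg_one_lt_tanh y], by linarith [tanh_lt_one y]⟩

lemma coe_spinProb (y : ℝ) : (spinProb y : ℝ) = (1 + tanh y) / 2 := rfl

lemma two_mul_spinProb_sub_one (y : ℝ) : 2 * (spinProb y : ℝ) - 1 = tanh y := by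
  rw [coe_spinProb]
  ring

lemma hasDerivAt_spinProb (y : ℝ) :
    HasDerivAt (fun y => (spinProb y : ℝ)) ((cosh y ^ 2)⁻¹ / 2) y := by
  rw [← one_sub_tanh_sq]
  exact ((hasDerivAt_tanh y).const_add 1).div_const 2

lemma measurable_spinProb : Measurable spinProb :=
  ((continuous_tanh.const_add 1).div_const 2).measurable.subtype_mk

lemma injective_coe_spinProb : Function.Injective fun y => (spinProb y : ℝ) := by
  intro x y (h : (spinProb x : ℝ) = spinProb y)
  exact tanh_injective (by rw [← two_mul_spinProb_sub_one, h, two_mul_spinProb_sub_one])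

lemma range_coe_spinProb : Set.range (fun y => (spinProb y : ℝ)) = Set.Ioo 0 1 := by
  refine Set.Subset.antisymm (Set.range_subset_iff.2 fun y => ?_) fun p hp => ?_
  · rw [coe_spinProb]
    exact ⟨by linarith [neg_one_lt_tanh y], by linarith [tanh_lt_one y]⟩
  · refine ⟨artanh (2 * p - 1), ?_⟩
    have h : tanh (artanh (2 * p - 1)) = 2 * p - 1 :=
      tanh_artanh ⟨by linarith [hp.1], by linarith [hp.2]⟩
    simp only [coe_spinProb, h]
    ring

lemma tilted_mul_spinLaw (y : ℝ) : spinLaw.tilted (fun x => y * x) = signLaw (spinProb y) := by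
  refine ext_of_forall_integral_eq_of_IsFiniteMeasure fun f => ?_
  have hc : cosh y ≠ 0 := (cosh_pos y).ne'
  rw [integral_tilted, integral_exp_mul_spinLaw, integral_spinLaw, integral_signLaw, coe_spinProb,
    tanh_eq_sinh_div_cosh, mul_one, mul_neg_one, ← cosh_add_sinh, ← cosh_sub_sinh]
  simp only [smul_eq_mul]
  field_simp
  ring

lemma pi_signLaw_spinProb (n : ℕ) (y : ℝ) :
    Measure.pi (fun _ : Fin n => signLaw (spinProb y))
      = (Measure.pi fun _ : Fin n => spinLaw).tilted fun x => y * ∑ k, x k := by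
  simp_rw [← tilted_mul_spinLaw, pi_tilted, Finset.mul_sum]

lemma measurable_coupledSpin : Measurable fun q : ℝ × ℝ => coupledSpin q.1 q.2 :=
  ((Measurable.ite (measurableSet_lt measurable_fst measurable_snd) measurable_const
    measurable_const).const_mul 2).sub_const 1

lemma map_coupledSpin (p : unitInterval) :
    ((volume : Measure ℝ).restrict (Set.Icc 0 1)).map (fun u => coupledSpin u p) = signLaw p := by
  have hm : Measurable fun u => coupledSpin u p :=
    measurable_coupledSpin.comp (measurable_id.prodMk measurable_const)
  have hsplit : (volume : Measure ℝ).restrict (Set.Icc 0 1)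
      = volume.restrict (Set.Ico 0 (p : ℝ)) + volume.restrict (Set.Icc (p : ℝ) 1) := by
    rw [← Set.Ico_union_Icc_eq_Icc p.2.1 p.2.2, Measure.restrict_union
      (Set.disjoint_left.2 fun u hu hu' => (hu.2.trans_le hu'.1).false) measurableSet_Icc]
  have hlow : (volume.restrict (Set.Ico 0 (p : ℝ))).map (fun u => coupledSpin u p)
      = ENNReal.ofReal p • Measure.dirac 1 := by
    rw [Measure.map_congr (g := fun _ => (1 : ℝ)) <| (ae_restrict_mem measurableSet_Ico).mono
      fun u hu => by simp [coupledSpin, hu.2]; norm_num, Measure.map_const]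
    simp
  have hhigh : (volume.restrict (Set.Icc (p : ℝ) 1)).map (fun u => coupledSpin u p)
      = ENNReal.ofReal (1 - p) • Measure.dirac (-1) := by
    rw [Measure.map_congr (g := fun _ => (-1 : ℝ)) <| (ae_restrict_mem measurableSet_Icc).mono
      fun u hu => by simp [coupledSpin, hu.1], Measure.map_const]
    simp
  rw [hsplit, Measure.map_add _ _ hm, hlow, hhigh, ENNReal.ofReal_eq_coe_nnreal p.2.1,
    ENNReal.ofReal_eq_coe_nnreal (sub_nonneg.2 p.2.2)]
  rfl

lemma integrable_exp_mul_sq_of_ae_abs_le {Ω : Type*} [MeasurableSpace Ω] {μ : Measure Ω}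
    [IsFiniteMeasure μ] {S : Ω → ℝ} {C : ℝ} (hS : AEMeasurable S μ) (hC : ∀ᵐ x ∂μ, |S x| ≤ C)
    (c : ℝ) : Integrable (fun x => exp (c * S x ^ 2)) μ := by
  refine (integrable_const (exp (|c| * C ^ 2))).mono' (by fun_prop) ?_
  filter_upwards [hC] with x hx
  rw [norm_of_nonneg (exp_pos _).le, exp_le_exp]
  calc c * S x ^ 2 ≤ |c| * |S x| ^ 2 := by
        rw [sq_abs]
        gcongr
        exact le_abs_self c
    _ ≤ |c| * C ^ 2 := by gcongr

lemma ae_abs_sum_le (n : ℕ) :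
    ∀ᵐ x : Fin n → ℝ ∂(Measure.pi fun _ : Fin n => spinLaw), |∑ k, x k| ≤ n := by
  have h : ∀ᵐ x ∂(Measure.pi fun _ : Fin n => spinLaw), ∀ k, |x k| = 1 :=
    ae_all_iff.2 fun k => (Measure.tendsto_eval_ae_ae (μ := fun _ : Fin n => spinLaw)
      (i := k)).eventually (ae_abs_eq_one_signLaw _)
  filter_upwards [h] with x hx
  calc |∑ k, x k| ≤ ∑ k, |x k| := Finset.abs_sum_le_sum_abs _ _
    _ = n := by simp [hx]

lemma integrable_exp_mul_sum_sq (n : ℕ) (c : ℝ) :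
    Integrable (fun x : Fin n → ℝ => exp (c * (∑ k, x k) ^ 2))
      (Measure.pi fun _ : Fin n => spinLaw) :=
  integrable_exp_mul_sq_of_ae_abs_le (by fun_prop) (ae_abs_sum_le n) c

instance isProbabilityMeasure_curieWeissMeasure (n : ℕ) (b : ℝ) :
    IsProbabilityMeasure (curieWeissMeasure n b) :=
  isProbabilityMeasure_tilted (integrable_exp_mul_sum_sq n _)

/-- The logarithm of the unnormalised density of the random external field. -/
def fieldExponent (n : ℕ) (b y : ℝ) : ℝ := -(n / (2 * b)) * y ^ 2 + n * log (cosh y)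

/-- The law of the random external field `y` given which Curie-Weiss spins are independent with
mean `tanh y`. -/
def fieldLaw (n : ℕ) (b : ℝ) : Measure ℝ := (volume : Measure ℝ).tilted (fieldExponent n b)

lemma continuous_fieldExponent (n : ℕ) (b : ℝ) : Continuous (fieldExponent n b) := by
  have : Continuous fun y => log (cosh y) := continuous_cosh.log fun y => (cosh_pos y).ne'
  unfold fieldExponent
  fun_prop

lemma cgf_sum_pi_spinLaw (n : ℕ) (y : ℝ) :
    cgf (fun x : Fin n → ℝ => ∑ k, x k) (Measure.pi fun _ => spinLaw) y = n * log (cosh y) := by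
  simp_rw [cgf, mgf, Finset.mul_sum, exp_sum]
  rw [integral_fintype_prod_eq_pow (fun x => exp (y * x)), integral_exp_mul_spinLaw,
    Fintype.card_fin, log_pow]

lemma fieldExponent_eq_cgf (n : ℕ) (b : ℝ) :
    fieldExponent n b = fun y => -(n / (2 * b)) * y ^ 2
      + cgf (fun x : Fin n → ℝ => ∑ k, x k) (Measure.pi fun _ => spinLaw) y := by
  simp_rw [cgf_sum_pi_spinLaw]
  rfl

lemma sq_div_four_mul (n : ℕ) (b s : ℝ) :
    s ^ 2 / (4 * (n / (2 * b))) = b / (2 * n) * s ^ 2 := by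
  rw [← mul_div_assoc, div_div_eq_mul_div]
  ring

lemma isProbabilityMeasure_fieldLaw {n : ℕ} {b : ℝ} (hn : 0 < n) (hb : 0 < b) :
    IsProbabilityMeasure (fieldLaw n b) := by
  refine isProbabilityMeasure_tilted ?_
  rw [fieldExponent_eq_cgf]
  refine integrable_exp_neg_mul_sq_add_cgf (by positivity) (by fun_prop) ?_
  simp_rw [sq_div_four_mul]
  exact integrable_exp_mul_sum_sq n _

lemma lintegral_pi_signLaw_fieldLaw {n : ℕ} {b : ℝ} (hn : 0 < n) (hb : 0 < b)
    {s : Set (Fin n → ℝ)} (hs : MeasurableSet s) :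
    ∫⁻ y, Measure.pi (fun _ => signLaw (spinProb y)) s ∂fieldLaw n b
      = curieWeissMeasure n b s := by
  have h := lintegral_tilted_mul_apply_eq_tilted_sq_apply (μ := Measure.pi fun _ : Fin n => spinLaw)
    (S := fun x => ∑ k, x k) (a := n / (2 * b)) (by positivity) (by fun_prop)
    (by simpa only [sq_div_four_mul] using integrable_exp_mul_sum_sq n _) hs
  simp_rw [sq_div_four_mul] at h
  simp_rw [pi_signLaw_spinProb, fieldLaw, fieldExponent_eq_cgf]
  exact h

lemma abs_deriv_spinProb_mul_deFinetti_density (n : ℕ) (b y : ℝ) :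
    |(cosh y ^ 2)⁻¹ / 2| * exp (-(n / (2 * b)) * artanh (2 * (spinProb y : ℝ) - 1) ^ 2
      - (n / 2 + 1) * log (1 - (2 * (spinProb y : ℝ) - 1) ^ 2))
      = 1 / 2 * exp (fieldExponent n b y) := by
  have hc : 0 < cosh y ^ 2 := pow_pos (cosh_pos y) 2
  have h : (cosh y ^ 2)⁻¹ = exp (-(2 * log (cosh y))) := by
    rw [exp_neg, ← exp_log hc, log_pow]
    norm_num
  rw [two_mul_spinProb_sub_one, artanh_tanh, one_sub_tanh_sq, log_inv, log_pow,
    abs_of_pos (by positivity), h, div_eq_inv_mul, mul_assoc, ← exp_add, one_div, fieldExponent]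
  congr 2
  push_cast
  ring

lemma deFinettiMeasure_eq_map (n : ℕ) (b : ℝ) :
    deFinettiMeasure n b = (fieldLaw n b).map fun y => (spinProb y : ℝ) := by
  rw [deFinettiMeasure, ← range_coe_spinProb]
  exact (map_tilted_volume hasDerivAt_spinProb injective_coe_spinProb one_half_pos
    (abs_deriv_spinProb_mul_deFinetti_density n b)).symm

lemma isProbabilityMeasure_deFinettiMeasure {n : ℕ} {b : ℝ} (hn : 0 < n) (hb : 0 < b) :
    IsProbabilityMeasure (deFinettiMeasure n b) := by
  have := isProbabilityMeasure_fieldLaw hn hb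
  rw [deFinettiMeasure_eq_map]
  exact Measure.isProbabilityMeasure_map measurable_spinProb.subtype_val.aemeasurable

instance : IsProbabilityMeasure ((volume : Measure ℝ).restrict (Set.Icc 0 1)) := ⟨by simp⟩

lemma map_coupledSpin_pi (n : ℕ) (p : unitInterval) :
    (Measure.pi fun _ : Fin n => (volume : Measure ℝ).restrict (Set.Icc 0 1)).map
        (fun u k => coupledSpin (u k) p) = Measure.pi fun _ => signLaw p := by
  have h := Measure.pi_map_pi (μ := fun _ : Fin n => (volume : Measure ℝ).restrict (Set.Icc 0 1))
    (f := fun _ u => coupledSpin u p) (hμ := fun _ => by rw [map_coupledSpin]; infer_instance)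
    fun _ => (measurable_coupledSpin.comp (by fun_prop :
      Measurable fun u : ℝ => (u, (p : ℝ)))).aemeasurable
  simpa only [map_coupledSpin] using h

lemma measurable_coupledSpin_pi (n : ℕ) (p : ℝ) :
    Measurable fun (u : Fin n → ℝ) k => coupledSpin (u k) p :=
  measurable_pi_lambda _ fun k => measurable_coupledSpin.comp (by fun_prop :
    Measurable fun u : Fin n → ℝ => (u k, p))

/-- The spins produced by uniform variables `q.1` and a success probability `q.2`, paired with that
probability. -/
def coupling (n : ℕ) (q : (Fin n → ℝ) × ℝ) : (Fin n → ℝ) × ℝ :=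
  (fun k => coupledSpin (q.1 k) q.2, q.2)

lemma measurable_coupling (n : ℕ) : Measurable (coupling n) :=
  (measurable_pi_lambda _ fun k => measurable_coupledSpin.comp (by fun_prop :
    Measurable fun q : (Fin n → ℝ) × ℝ => (q.1 k, q.2))).prodMk measurable_snd

/-- The joint law of the coupled Curie-Weiss spins and of their De Finetti variable. -/
def coupledLaw (n : ℕ) (b : ℝ) : Measure ((Fin n → ℝ) × ℝ) :=
  ((Measure.pi fun _ : Fin n => (volume : Measure ℝ).restrict (Set.Icc 0 1)).prod
    (deFinettiMeasure n b)).map (coupling n)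

lemma isProbabilityMeasure_coupledLaw {n : ℕ} {b : ℝ} (hn : 0 < n) (hb : 0 < b) :
    IsProbabilityMeasure (coupledLaw n b) := by
  have := isProbabilityMeasure_deFinettiMeasure hn hb
  exact Measure.isProbabilityMeasure_map (measurable_coupling n).aemeasurable

lemma fst_coupledLaw {n : ℕ} {b : ℝ} (hn : 0 < n) (hb : 0 < b) :
    (coupledLaw n b).fst = curieWeissMeasure n b := by
  have := isProbabilityMeasure_deFinettiMeasure hn hb
  ext s hs
  have hm : MeasurableSet (coupling n ⁻¹' (Prod.fst ⁻¹' s)) :=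
    measurable_coupling n (measurable_fst hs)
  rw [Measure.fst_apply hs, coupledLaw, Measure.map_apply (measurable_coupling n)
    (measurable_fst hs), Measure.prod_apply_symm hm, deFinettiMeasure_eq_map,
    lintegral_map (measurable_measure_prodMk_right hm) measurable_spinProb.subtype_val,
    ← lintegral_pi_signLaw_fieldLaw hn hb hs]
  refine lintegral_congr fun y => ?_
  rw [← map_coupledSpin_pi, Measure.map_apply (measurable_coupledSpin_pi n _) hs]
  rfl

lemma integral_coupledLaw {E : Type*} [NormedAddCommGroup E] [NormedSpace ℝ E]
    {n : ℕ} {b : ℝ} (hn : 0 < n) (hb : 0 < b) {f : (Fin n → ℝ) × ℝ → E}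
    (hf : StronglyMeasurable f) (hint : Integrable f (coupledLaw n b)) :
    ∫ q, f q ∂coupledLaw n b
      = ∫ y, ∫ x, f (x, spinProb y) ∂Measure.pi (fun _ => signLaw (spinProb y)) ∂fieldLaw n b := by
  have := isProbabilityMeasure_deFinettiMeasure hn hb
  have hfc : StronglyMeasurable fun q => f (coupling n q) :=
    hf.comp_measurable (measurable_coupling n)
  rw [coupledLaw, integral_map (measurable_coupling n).aemeasurable hf.aestronglyMeasurable,
    integral_prod_symm (fun q => f (coupling n q)) ((integrable_map_measure hf.aestronglyMeasurable
      (measurable_coupling n).aemeasurable).1 hint), deFinettiMeasure_eq_map,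
    integral_map measurable_spinProb.subtype_val.aemeasurable
      hfc.integral_prod_left'.aestronglyMeasurable]
  refine integral_congr_ae (Eventually.of_forall fun y => ?_)
  have hfy : StronglyMeasurable fun x : Fin n → ℝ => f (x, spinProb y) :=
    hf.comp_measurable (by fun_prop)
  simp only [← map_coupledSpin_pi]
  exact (integral_map (measurable_coupledSpin_pi n _).aemeasurable hfy.aestronglyMeasurable).symm

lemma IsUniformCoupling.hasLaw_coupledLaw {Ω : Type*} [MeasurableSpace Ω] {n : ℕ} {b : ℝ}
    {U : Fin n → Ω → ℝ} {V : Ω → ℝ} {P : Measure Ω} [IsProbabilityMeasure P]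
    (h : IsUniformCoupling n b U V P) :
    HasLaw (fun ω => (fun k => coupledSpin (U k ω) (V ω), V ω)) (coupledLaw n b) P :=
  HasLaw.comp ⟨(measurable_coupling n).aemeasurable, rfl⟩
    (h.indep.hasLaw_prod (iIndepFun.hasLaw_pi h.uniform h.iIndep) h.deFinetti)

lemma IsUniformCoupling.hasLaw_coupledSpin {Ω : Type*} [MeasurableSpace Ω] {n : ℕ} {b : ℝ}
    {U : Fin n → Ω → ℝ} {V : Ω → ℝ} {P : Measure Ω} [IsProbabilityMeasure P]
    (hn : 0 < n) (hb : 0 < b) (h : IsUniformCoupling n b U V P) :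
    HasLaw (fun ω k => coupledSpin (U k ω) (V ω)) (curieWeissMeasure n b) P :=
  HasLaw.comp ⟨measurable_fst.aemeasurable, fst_coupledLaw hn hb⟩ h.hasLaw_coupledLaw

lemma tendsto_sqrt_natCast : Tendsto (fun n : ℕ => √(n : ℝ)) atTop atTop :=
  tendsto_sqrt_atTop.comp tendsto_natCast_atTop_atTop

lemma norm_exp_mul_I_sub_taylor_le {z : ℝ} (hz : |z| ≤ 1) :
    ‖Complex.exp (z * Complex.I) - (1 + z * Complex.I - z ^ 2 / 2)‖ ≤ |z| ^ 3 := by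
  have hn : ‖(z : ℂ) * Complex.I‖ = |z| := by simp
  have h := Complex.exp_bound (x := (z : ℂ) * Complex.I) (by rwa [hn]) (n := 3) (by norm_num)
  have htaylor : ∑ m ∈ Finset.range 3, ((z : ℂ) * Complex.I) ^ m / (m.factorial : ℂ)
      = 1 + z * Complex.I - z ^ 2 / 2 := by
    simp only [Finset.sum_range_succ, Finset.sum_range_zero, mul_pow, Complex.I_sq]
    norm_num
    ring
  rw [hn, htaylor] at h
  refine h.trans (mul_le_of_le_one_right (by positivity) ?_)
  norm_num [Nat.factorial]

lemma integrable_ofReal_pow_of_ae_abs_le {μ : Measure ℝ} [IsFiniteMeasure μ] {C : ℝ}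
    (hC : ∀ᵐ x ∂μ, |x| ≤ C) (k : ℕ) : Integrable (fun x : ℝ => (x : ℂ) ^ k) μ := by
  refine Integrable.of_bound (by fun_prop) (C ^ k) ?_
  filter_upwards [hC] with x hx
  rw [norm_pow, Complex.norm_real]
  exact pow_le_pow_left₀ (abs_nonneg x) hx k

lemma norm_charFun_sub_le {μ : Measure ℝ} [IsProbabilityMeasure μ] {C u : ℝ}
    (hC : ∀ᵐ x ∂μ, |x| ≤ C) (hμ : ∫ x, x ∂μ = 0) (hu : |u| * C ≤ 1) :
    ‖charFun μ u - (1 - (u ^ 2 * ∫ x, x ^ 2 ∂μ) / 2 : ℝ)‖ ≤ (|u| * C) ^ 3 := by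
  have hlin : Integrable (fun x : ℝ => u * Complex.I * (x : ℂ)) μ := by
    simpa using (integrable_ofReal_pow_of_ae_abs_le hC 1).const_mul (u * Complex.I)
  have hquad : Integrable (fun x : ℝ => (u : ℂ) ^ 2 / 2 * (x : ℂ) ^ 2) μ :=
    (integrable_ofReal_pow_of_ae_abs_le hC 2).const_mul _
  have haff : Integrable (fun x : ℝ => 1 + u * Complex.I * (x : ℂ)) μ :=
    (integrable_const 1).add hlin
  have hpoly : Integrable
      (fun x : ℝ => 1 + u * Complex.I * (x : ℂ) - (u : ℂ) ^ 2 / 2 * (x : ℂ) ^ 2) μ :=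
    haff.sub hquad
  have hint : ∫ x : ℝ, (1 + u * Complex.I * (x : ℂ) - (u : ℂ) ^ 2 / 2 * (x : ℂ) ^ 2) ∂μ
      = ((1 - (u ^ 2 * ∫ x, x ^ 2 ∂μ) / 2 : ℝ) : ℂ) := by
    rw [integral_sub haff hquad, integral_add (integrable_const 1) hlin, integral_const_mul,
      integral_const_mul, integral_complex_ofReal, hμ, integral_const, probReal_univ, one_smul]
    simp_rw [← Complex.ofReal_pow]
    rw [integral_complex_ofReal]
    push_cast
    ring
  have hexp : Integrable (fun x : ℝ => Complex.exp (u * x * Complex.I)) μ := by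
    refine .of_bound (by fun_prop) 1 (.of_forall fun x => ?_)
    rw [← Complex.ofReal_mul, Complex.norm_exp_ofReal_mul_I]
  rw [← hint, charFun_apply_real, ← integral_sub hexp hpoly]
  refine (norm_integral_le_of_norm_le_const (C := (|u| * C) ^ 3) ?_).trans (by simp)
  filter_upwards [hC] with x hx
  have hux : |u * x| ≤ |u| * C := by
    rw [abs_mul]
    gcongr
  calc _ = ‖Complex.exp ((u * x : ℝ) * Complex.I)
          - (1 + (u * x : ℝ) * Complex.I - ((u * x : ℝ) : ℂ) ^ 2 / 2)‖ := by
        push_cast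
        ring_nf
    _ ≤ |u * x| ^ 3 := norm_exp_mul_I_sub_taylor_le (hux.trans hu)
    _ ≤ (|u| * C) ^ 3 := pow_le_pow_left₀ (abs_nonneg _) hux 3

lemma tendsto_charFun_div_sqrt_pow {μ : ℕ → Measure ℝ} [∀ n, IsProbabilityMeasure (μ n)]
    {C v s : ℝ} {σ : ℕ → ℝ} (hC : ∀ n, ∀ᵐ x ∂μ n, |x| ≤ C) (hμ : ∀ n, ∫ x, x ∂μ n = 0)
    (hv : Tendsto (fun n => ∫ x, x ^ 2 ∂μ n) atTop (𝓝 v)) (hσ : Tendsto σ atTop (𝓝 s)) :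
    Tendsto (fun n : ℕ => charFun (μ n) (σ n / √n) ^ n) atTop
      (𝓝 (Complex.exp (-(s ^ 2 * v / 2 : ℝ)))) := by
  have hu : Tendsto (fun n : ℕ => |σ n / √n| * C) atTop (𝓝 0) := by
    simpa using (hσ.div_atTop tendsto_sqrt_natCast).abs.mul_const C
  have hmain : Tendsto (fun n => -(σ n ^ 2 * (∫ x, x ^ 2 ∂μ n) / 2)) atTop
      (𝓝 (-(s ^ 2 * v / 2))) := (((hσ.pow 2).mul hv).div_const 2).neg
  have hrem : Tendsto (fun n : ℕ => (n : ℂ) * (charFun (μ n) (σ n / √n) - 1)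
      - (-(σ n ^ 2 * (∫ x, x ^ 2 ∂μ n) / 2) : ℝ)) atTop (𝓝 0) := by
    have hbound : Tendsto (fun n : ℕ => σ n ^ 2 * C ^ 2 * (|σ n / √n| * C)) atTop (𝓝 0) := by
      simpa using ((hσ.pow 2).mul_const (C ^ 2)).mul hu
    refine squeeze_zero_norm' ?_ hbound
    filter_upwards [eventually_gt_atTop 0, hu.eventually_le_const one_pos] with n hn hn1
    have hsq : (n : ℝ) * (σ n / √n) ^ 2 = σ n ^ 2 := by
      rw [div_pow, sq_sqrt n.cast_nonneg]
      field_simp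
    have htaylor := norm_charFun_sub_le (hC n) (hμ n) hn1
    generalize σ n / √n = u at *
    calc _ = ‖(n : ℂ) * (charFun (μ n) u - (1 - (u ^ 2 * ∫ x, x ^ 2 ∂μ n) / 2 : ℝ))‖ := by
          rw [← hsq]
          congr 1
          push_cast
          ring
      _ ≤ n * (|u| * C) ^ 3 := by
          rw [norm_mul, Complex.norm_natCast]
          gcongr
      _ = σ n ^ 2 * C ^ 2 * (|u| * C) := by
          rw [← hsq, ← sq_abs u]
          ring
  have h := hrem.add ((Complex.continuous_ofReal.tendsto _).comp hmain)
  rw [zero_add] at h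
  have := Complex.tendsto_one_add_pow_exp_of_tendsto (g := fun n => charFun (μ n) (σ n / √n) - 1)
    (by simpa using h)
  simpa using this

/-- The law of a sign that is positive with probability `p`, minus its mean. -/
def centredSignLaw (p : unitInterval) : Measure ℝ := (signLaw p).map fun x => x - (2 * p - 1)

instance (p : unitInterval) : IsProbabilityMeasure (centredSignLaw p) :=
  Measure.isProbabilityMeasure_map (by fun_prop)

lemma integral_centredSignLaw {E : Type*} [NormedAddCommGroup E] [NormedSpace ℝ E]
    (p : unitInterval) {f : ℝ → E} (hf : Continuous f) :
    ∫ x, f x ∂centredSignLaw p = ∫ x, f (x - (2 * p - 1)) ∂signLaw p :=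
  integral_map (by fun_prop) hf.aestronglyMeasurable

lemma integral_id_centredSignLaw (p : unitInterval) : ∫ x, x ∂centredSignLaw p = 0 := by
  rw [integral_centredSignLaw p continuous_id', integral_signLaw]
  simp only [smul_eq_mul]
  ring

lemma integral_sq_centredSignLaw (p : unitInterval) :
    ∫ x, x ^ 2 ∂centredSignLaw p = 1 - (2 * p - 1 : ℝ) ^ 2 := by
  rw [integral_centredSignLaw p (by fun_prop), integral_signLaw]
  simp only [smul_eq_mul]
  ring

lemma charFun_centredSignLaw (p : unitInterval) (u : ℝ) :
    charFun (centredSignLaw p) u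
      = ∫ x, Complex.exp ((u * (x - (2 * p - 1)) : ℝ) * Complex.I) ∂signLaw p := by
  rw [charFun_apply_real, integral_centredSignLaw p (by fun_prop)]
  simp only [Complex.ofReal_mul]

lemma ae_abs_le_centredSignLaw (p : unitInterval) : ∀ᵐ x ∂centredSignLaw p, |x| ≤ 2 := by
  rw [centredSignLaw, ae_map_iff (by fun_prop) (measurableSet_le (by fun_prop) (by fun_prop))]
  filter_upwards [ae_abs_eq_one_signLaw p] with x hx
  calc |x - (2 * p - 1)| ≤ |x| + |2 * (p : ℝ) - 1| := abs_sub _ _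
    _ ≤ 1 + 1 := add_le_add hx.le (abs_le.2 ⟨by linarith [p.2.1], by linarith [p.2.2]⟩)
    _ = 2 := by norm_num

lemma tendsto_pow_four_mul_logCoshDefect_div {ι : Type*} {l : Filter ι} {r : ι → ℝ}
    (hr : Tendsto r l atTop) (x : ℝ) :
    Tendsto (fun i => r i ^ 4 * logCoshDefect (x / r i)) l (𝓝 (x ^ 4 / 12)) := by
  have h0 : Tendsto (fun i => x / r i) l (𝓝 0) := tendsto_const_nhds.div_atTop hr
  have hlower : Tendsto (fun i => x ^ 4 / (1 + (x / r i) ^ 2) / 12) l (𝓝 (x ^ 4 / 12)) := by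
    simpa using ((tendsto_const_nhds (x := x ^ 4)).div ((h0.pow 2).const_add 1)
      (by norm_num)).div_const 12
  refine tendsto_of_tendsto_of_tendsto_of_le_of_le' hlower tendsto_const_nhds ?_ ?_
  all_goals filter_upwards [hr.eventually_gt_atTop 0] with i hi
  · calc x ^ 4 / (1 + (x / r i) ^ 2) / 12
        = r i ^ 4 * ((x / r i) ^ 4 / (1 + (x / r i) ^ 2) / 12) := by field_simp
      _ ≤ r i ^ 4 * logCoshDefect (x / r i) := by gcongr; exact le_logCoshDefect _
  · calc r i ^ 4 * logCoshDefect (x / r i) ≤ r i ^ 4 * ((x / r i) ^ 4 / 12) := by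
          gcongr
          exact logCoshDefect_le _
      _ = x ^ 4 / 12 := by field_simp

lemma le_pow_four_mul_logCoshDefect_div {R r : ℝ} (hR : 0 ≤ R) (hr : 0 < r) (hRr : R ≤ r ^ 2)
    (x : ℝ) : R * (x ^ 2 - R) / 12 ≤ r ^ 4 * logCoshDefect (x / r) := by
  have hquartic : R * (x ^ 2 - R) ≤ x ^ 4 * r ^ 2 / (r ^ 2 + x ^ 2) := by
    have hpos : 0 ≤ (r ^ 2 - R) * (x ^ 4 - R * x ^ 2 + R ^ 2) :=
      mul_nonneg (sub_nonneg.2 hRr) (by linarith [sq_nonneg (x ^ 2 - R / 2), sq_nonneg R])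
    rw [le_div_iff₀ (by positivity)]
    linarith [pow_nonneg hR 3]
  calc R * (x ^ 2 - R) / 12 ≤ x ^ 4 * r ^ 2 / (r ^ 2 + x ^ 2) / 12 := by gcongr
    _ = r ^ 4 * ((x / r) ^ 4 / (1 + (x / r) ^ 2) / 12) := by field_simp
    _ ≤ r ^ 4 * logCoshDefect (x / r) := by gcongr; exact le_logCoshDefect _

lemma fieldExponent_div {n : ℕ} {b r : ℝ} (hb : b ≠ 0) (hr : r ≠ 0) (hn : r ^ 4 = n) (x : ℝ) :
    fieldExponent n b (x / r)
      = -(r ^ 2 * (1 - b) / b) * (x ^ 2 / 2) - r ^ 4 * logCoshDefect (x / r) := by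
  rw [fieldExponent, logCoshDefect, ← hn]
  field_simp
  ring

lemma natCast_rpow_quarter_pow_four (n : ℕ) : ((n : ℝ) ^ (1 / 4 : ℝ)) ^ 4 = n := by
  rw [← rpow_mul_natCast n.cast_nonneg]
  norm_num

lemma natCast_rpow_quarter_sq (n : ℕ) : ((n : ℝ) ^ (1 / 4 : ℝ)) ^ 2 = √(n : ℝ) := by
  rw [← rpow_mul_natCast n.cast_nonneg, sqrt_eq_rpow]
  norm_num

lemma natCast_rpow_quarter_cube (n : ℕ) :
    ((n : ℝ) ^ (1 / 4 : ℝ)) ^ 3 = (n : ℝ) ^ (3 / 4 : ℝ) := by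
  rw [← rpow_mul_natCast n.cast_nonneg]
  norm_num

lemma natCast_rpow_quarter_pos {n : ℕ} (hn : 0 < n) : 0 < (n : ℝ) ^ (1 / 4 : ℝ) :=
  rpow_pos_of_pos (Nat.cast_pos.2 hn) _

lemma tendsto_natCast_rpow_quarter : Tendsto (fun n : ℕ => (n : ℝ) ^ (1 / 4 : ℝ)) atTop atTop :=
  (tendsto_rpow_atTop (by norm_num)).comp tendsto_natCast_atTop_atTop

lemma tendsto_natCast_rpow_quarter_mul_tanh_div (x : ℝ) :
    Tendsto (fun n : ℕ => (n : ℝ) ^ (1 / 4 : ℝ) * tanh (x / (n : ℝ) ^ (1 / 4 : ℝ))) atTop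
      (𝓝 x) := by
  have h := (hasDerivAt_tanh 0).hasFDerivAt.lim x (l := atTop)
    (c := fun n : ℕ => (n : ℝ) ^ (1 / 4 : ℝ))
    (tendsto_norm_atTop_atTop.comp tendsto_natCast_rpow_quarter)
  simpa [div_eq_inv_mul] using h

lemma integrable_exp_sub_sq (C : ℝ) : Integrable fun x : ℝ => exp (C - x ^ 2) := by
  simpa only [neg_one_mul, ← exp_add, ← sub_eq_add_neg]
    using (integrable_exp_neg_mul_sq one_pos).const_mul (exp C)

instance isProbabilityMeasure_limitLaw (γ : ℝ) : IsProbabilityMeasure (limitLaw γ) := by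
  refine isProbabilityMeasure_tilted ((integrable_exp_sub_sq (3 * (γ - 2) ^ 2 / 4)).mono'
    (by fun_prop) (Eventually.of_forall fun x => ?_))
  rw [norm_of_nonneg (exp_pos _).le, exp_le_exp]
  linarith [sq_nonneg (x ^ 2 + 3 * γ - 6)]

section CriticalWindow

variable {γ : ℝ} {β : ℕ → ℝ} (hβ : Tendsto (fun n : ℕ => √n * (1 - β n)) atTop (𝓝 γ))

include hβ

lemma tendsto_one_of_tendsto_sqrt_mul : Tendsto β atTop (𝓝 1) := by
  have h := tendsto_const_nhds (x := (1 : ℝ)).sub (hβ.div_atTop tendsto_sqrt_natCast)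
  rw [sub_zero] at h
  refine h.congr' ?_
  filter_upwards [eventually_gt_atTop 0] with n hn
  have : √(n : ℝ) ≠ 0 := (sqrt_pos.2 (Nat.cast_pos.2 hn)).ne'
  field_simp
  ring

lemma eventually_pos_of_tendsto_sqrt_mul : ∀ᶠ n in atTop, 0 < n ∧ 0 < β n :=
  (eventually_gt_atTop 0).and
    ((tendsto_one_of_tendsto_sqrt_mul hβ).eventually (eventually_gt_nhds one_pos))

lemma tendsto_fieldExponent_div (x : ℝ) :
    Tendsto (fun n : ℕ => fieldExponent n (β n) (x / (n : ℝ) ^ (1 / 4 : ℝ))) atTop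
      (𝓝 (-(x ^ 4 / 12) - γ * (x ^ 2 / 2))) := by
  have hcoeff := (hβ.div (tendsto_one_of_tendsto_sqrt_mul hβ) one_ne_zero).neg.mul_const (x ^ 2 / 2)
  have h := hcoeff.sub (tendsto_pow_four_mul_logCoshDefect_div tendsto_natCast_rpow_quarter x)
  rw [div_one, neg_mul, neg_sub_left, neg_add'] at h
  refine h.congr' ?_
  filter_upwards [eventually_pos_of_tendsto_sqrt_mul hβ] with n hn
  rw [fieldExponent_div hn.2.ne' (natCast_rpow_quarter_pos hn.1).ne'
    (natCast_rpow_quarter_pow_four n), natCast_rpow_quarter_sq]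
  rfl

lemma exists_eventually_fieldExponent_div_le :
    ∃ C : ℝ, ∀ᶠ n : ℕ in atTop, ∀ x : ℝ,
      fieldExponent n (β n) (x / (n : ℝ) ^ (1 / 4 : ℝ)) ≤ C - x ^ 2 := by
  set K := |γ| + 1
  set R := 6 * K + 12
  have hcoeff : ∀ᶠ n : ℕ in atTop, -K < √n * (1 - β n) / β n := by
    refine (hβ.div (tendsto_one_of_tendsto_sqrt_mul hβ) one_ne_zero).eventually
      (eventually_gt_nhds ?_)
    rw [div_one]
    linarith [neg_abs_le γ]
  refine ⟨R ^ 2 / 12, ?_⟩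
  filter_upwards [eventually_pos_of_tendsto_sqrt_mul hβ, hcoeff,
    tendsto_sqrt_natCast.eventually_ge_atTop R] with n hn hc hRn x
  rw [fieldExponent_div hn.2.ne' (natCast_rpow_quarter_pos hn.1).ne'
    (natCast_rpow_quarter_pow_four n), natCast_rpow_quarter_sq]
  have hquadratic : -(√n * (1 - β n) / β n) * (x ^ 2 / 2) ≤ K * (x ^ 2 / 2) := by
    gcongr
    linarith
  have hquartic := le_pow_four_mul_logCoshDefect_div (by positivity : 0 ≤ R)
    (natCast_rpow_quarter_pos hn.1) (by rwa [natCast_rpow_quarter_sq]) x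
  nlinarith

lemma tendsto_integral_fieldLaw {E : Type*} [NormedAddCommGroup E] [NormedSpace ℝ E]
    {Φ : ℕ → ℝ → E} {Ψ : ℝ → E} {C : ℝ} (hm : ∀ n, StronglyMeasurable (Φ n))
    (hb : ∀ n x, ‖Φ n x‖ ≤ C)
    (hlim : ∀ x, Tendsto (fun n : ℕ => Φ n (x / (n : ℝ) ^ (1 / 4 : ℝ))) atTop (𝓝 (Ψ x))) :
    Tendsto (fun n : ℕ => ∫ y, Φ n y ∂fieldLaw n (β n)) atTop (𝓝 (∫ x, Ψ x ∂limitLaw γ)) := by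
  obtain ⟨D, hD⟩ := exists_eventually_fieldExponent_div_le hβ
  have h := tendsto_integral_tilted
    (fun n => ((continuous_fieldExponent n (β n)).comp (continuous_id.div_const _)).aemeasurable)
    (fun n => ((hm n).comp_measurable (measurable_id.div_const _)).aestronglyMeasurable)
    (integrable_exp_sub_sq D) hD (Eventually.of_forall fun n x => hb n _)
    (tendsto_fieldExponent_div hβ) hlim
  refine h.congr' ?_
  filter_upwards [eventually_gt_atTop 0] with n hn
  exact integral_tilted_comp_div _ (Φ n) (natCast_rpow_quarter_pos hn).ne'

end CriticalWindow

/-- For spins `x` with De Finetti variable `v`: the rescaled fluctuation of the magnetisation around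
its conditional mean `n (2 v - 1)`, and that mean, rescaled. -/
def rescaledPair {n : ℕ} (x : Fin n → ℝ) (v : ℝ) : ℝ × ℝ :=
  ((n : ℝ) ^ (1 / 4 : ℝ) * ((∑ k, x k) / (n : ℝ) ^ (3 / 4 : ℝ)
      - (n : ℝ) ^ (1 / 4 : ℝ) * (2 * v - 1)),
    (n : ℝ) ^ (1 / 4 : ℝ) * (2 * v - 1))

lemma measurable_rescaledPair (n : ℕ) :
    Measurable fun q : (Fin n → ℝ) × ℝ => rescaledPair q.1 q.2 := by
  unfold rescaledPair
  fun_prop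

lemma measurable_exp_rescaledPair (n : ℕ) (s t : ℝ) :
    Measurable fun q : (Fin n → ℝ) × ℝ => Complex.exp
      ((s * (rescaledPair q.1 q.2).1 + t * (rescaledPair q.1 q.2).2 : ℝ) * Complex.I) :=
  have h := measurable_rescaledPair n
  Complex.measurable_exp.comp ((Complex.measurable_ofReal.comp
    ((h.fst.const_mul s).add (h.snd.const_mul t))).mul_const _)

lemma rescaledPair_fst {n : ℕ} (hn : 0 < n) (x : Fin n → ℝ) (v : ℝ) :
    (rescaledPair x v).1 = (∑ k, (x k - (2 * v - 1))) / √(n : ℝ) := by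
  rw [rescaledPair, ← natCast_rpow_quarter_sq, ← natCast_rpow_quarter_cube,
    Finset.sum_sub_distrib]
  simp only [Finset.sum_const, Finset.card_univ, Fintype.card_fin, nsmul_eq_mul]
  have h4 := natCast_rpow_quarter_pow_four n
  have := natCast_rpow_quarter_pos hn
  set r := (n : ℝ) ^ (1 / 4 : ℝ)
  rw [← h4]
  field_simp

lemma sum_div_eq_rescaledPair {n : ℕ} (hn : 0 < n) (x : Fin n → ℝ) (v : ℝ) :
    (∑ k, x k) / (n : ℝ) ^ (3 / 4 : ℝ)
      = (rescaledPair x v).1 / (n : ℝ) ^ (1 / 4 : ℝ) + (rescaledPair x v).2 := by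
  have := natCast_rpow_quarter_pos hn
  simp only [rescaledPair]
  field_simp
  ring

lemma integral_exp_rescaledPair_pi_signLaw {n : ℕ} (hn : 0 < n) (p : unitInterval) (s t : ℝ) :
    ∫ x, Complex.exp ((s * (rescaledPair x p).1 + t * (rescaledPair x p).2 : ℝ) * Complex.I)
        ∂Measure.pi (fun _ : Fin n => signLaw p)
      = charFun (centredSignLaw p) (s / √n) ^ n
        * Complex.exp ((t * ((n : ℝ) ^ (1 / 4 : ℝ) * (2 * p - 1)) : ℝ) * Complex.I) := by
  have hfactor (x : Fin n → ℝ) :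
      Complex.exp ((s * (rescaledPair x p).1 + t * (rescaledPair x p).2 : ℝ) * Complex.I)
        = (∏ k, Complex.exp ((s / √n * (x k - (2 * p - 1)) : ℝ) * Complex.I))
          * Complex.exp ((t * ((n : ℝ) ^ (1 / 4 : ℝ) * (2 * p - 1)) : ℝ) * Complex.I) := by
    rw [rescaledPair_fst hn, rescaledPair, ← Complex.exp_sum, ← Complex.exp_add,
      ← Finset.sum_mul, ← add_mul, ← Complex.ofReal_sum, ← Complex.ofReal_add, ← Finset.mul_sum]
    congr 4
    ring
  simp only [hfactor]
  rw [integral_mul_const, integral_fintype_prod_eq_pow (fun x : ℝ => Complex.exp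
    ((s / √n * (x - (2 * p - 1)) : ℝ) * Complex.I)), Fintype.card_fin, charFun_centredSignLaw]

lemma integral_exp_rescaledPair_coupledLaw {n : ℕ} {b : ℝ} (hn : 0 < n) (hb : 0 < b) (s t : ℝ) :
    ∫ q, Complex.exp ((s * (rescaledPair q.1 q.2).1 + t * (rescaledPair q.1 q.2).2 : ℝ)
        * Complex.I) ∂coupledLaw n b
      = ∫ y, charFun (centredSignLaw (spinProb y)) (s / √n) ^ n
        * Complex.exp ((t * ((n : ℝ) ^ (1 / 4 : ℝ) * tanh y) : ℝ) * Complex.I)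
        ∂fieldLaw n b := by
  have := isProbabilityMeasure_coupledLaw hn hb
  have hmeas := measurable_exp_rescaledPair n s t
  rw [integral_coupledLaw hn hb hmeas.stronglyMeasurable (Integrable.of_bound
    hmeas.aestronglyMeasurable 1 (ae_of_all _ fun q => (Complex.norm_exp_ofReal_mul_I _).le))]
  simp only [integral_exp_rescaledPair_pi_signLaw hn, two_mul_spinProb_sub_one]

lemma measurable_charFun_centredSignLaw_spinProb (u : ℝ) :
    Measurable fun y => charFun (centredSignLaw (spinProb y)) u := by
  simp only [charFun_centredSignLaw, integral_signLaw, coe_spinProb,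
    Complex.real_smul]
  exact Continuous.measurable (by fun_prop)

section CriticalWindow

variable {γ : ℝ} {β : ℕ → ℝ} (hβ : Tendsto (fun n : ℕ => √n * (1 - β n)) atTop (𝓝 γ))

lemma tendsto_charFun_centredSignLaw_spinProb_div {s : ℝ} {σ : ℕ → ℝ}
    (hσ : Tendsto σ atTop (𝓝 s)) (x : ℝ) :
    Tendsto (fun n : ℕ =>
        charFun (centredSignLaw (spinProb (x / (n : ℝ) ^ (1 / 4 : ℝ)))) (σ n / √n) ^ n)
      atTop (𝓝 (Complex.exp (-(s ^ 2 / 2 : ℝ)))) := by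
  have hx : Tendsto (fun n : ℕ => tanh (x / (n : ℝ) ^ (1 / 4 : ℝ))) atTop (𝓝 0) := by
    rw [← tanh_zero]
    exact (continuous_tanh.tendsto 0).comp
      (tendsto_const_nhds.div_atTop tendsto_natCast_rpow_quarter)
  have hvar : Tendsto (fun n : ℕ => 1 - tanh (x / (n : ℝ) ^ (1 / 4 : ℝ)) ^ 2) atTop (𝓝 1) := by
    simpa using (hx.pow 2).const_sub 1
  have h := tendsto_charFun_div_sqrt_pow (v := 1)
    (μ := fun n : ℕ => centredSignLaw (spinProb (x / (n : ℝ) ^ (1 / 4 : ℝ))))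
    (fun n => ae_abs_le_centredSignLaw _) (fun n => integral_id_centredSignLaw _)
    (by simpa only [integral_sq_centredSignLaw, two_mul_spinProb_sub_one] using hvar) hσ
  rwa [mul_one] at h

include hβ in
lemma tendsto_integral_exp_rescaledPair {s : ℝ} {σ : ℕ → ℝ} (hσ : Tendsto σ atTop (𝓝 s))
    (t : ℝ) :
    Tendsto (fun n : ℕ => ∫ q : (Fin n → ℝ) × ℝ, Complex.exp ((σ n * (rescaledPair q.1 q.2).1
        + t * (rescaledPair q.1 q.2).2 : ℝ) * Complex.I) ∂coupledLaw n (β n))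
      atTop (𝓝 (Complex.exp (-(s ^ 2 / 2 : ℝ)) * charFun (limitLaw γ) t)) := by
  have h := tendsto_integral_fieldLaw hβ (C := 1)
    (Φ := fun n y => charFun (centredSignLaw (spinProb y)) (σ n / √n) ^ n
      * Complex.exp ((t * ((n : ℝ) ^ (1 / 4 : ℝ) * tanh y) : ℝ) * Complex.I))
    (Ψ := fun x => Complex.exp (-(s ^ 2 / 2 : ℝ)) * Complex.exp ((t * x : ℝ) * Complex.I))
    (fun n => (((measurable_charFun_centredSignLaw_spinProb _).pow_const n).mul
      (Continuous.measurable (by fun_prop))).stronglyMeasurable) (fun n y => ?_)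
    fun x => (tendsto_charFun_centredSignLaw_spinProb_div hσ x).mul ?_
  · rw [charFun_apply_real, ← integral_const_mul]
    simp only [Complex.ofReal_mul] at h ⊢
    refine h.congr' ?_
    filter_upwards [eventually_pos_of_tendsto_sqrt_mul hβ] with n hn
    simpa only [Complex.ofReal_mul] using
      (integral_exp_rescaledPair_coupledLaw hn.1 hn.2 (σ n) t).symm
  · rw [norm_mul, Complex.norm_exp_ofReal_mul_I, mul_one, norm_pow]
    exact pow_le_one₀ (norm_nonneg _) (norm_charFun_le_one _)
  · have hexp : Continuous fun z : ℝ => Complex.exp ((z : ℂ) * Complex.I) := by fun_prop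
    exact (hexp.tendsto _).comp ((tendsto_natCast_rpow_quarter_mul_tanh_div x).const_mul t)

end CriticalWindow

lemma tendstoInDistribution_of_tendsto_charFun {E : Type*} [NormedAddCommGroup E]
    [InnerProductSpace ℝ E] [FiniteDimensional ℝ E] [MeasurableSpace E] [BorelSpace E]
    {Ω : ℕ → Type*} [∀ n, MeasurableSpace (Ω n)] {Ω' : Type*} [MeasurableSpace Ω']
    {P : ∀ n, Measure (Ω n)} [∀ n, IsProbabilityMeasure (P n)]
    {Q : Measure Ω'} [IsProbabilityMeasure Q] {X : ∀ n, Ω n → E} {Z : Ω' → E}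
    (hX : ∀ n, AEMeasurable (X n) (P n)) (hZ : AEMeasurable Z Q)
    (h : ∀ t, Tendsto (fun n => charFun ((P n).map (X n)) t) atTop (𝓝 (charFun (Q.map Z) t))) :
    TendstoInDistribution X atTop Z P Q :=
  ⟨hX, hZ, ProbabilityMeasure.tendsto_of_tendsto_charFun h⟩

lemma charFun_map_toLp {Ω : Type*} [MeasurableSpace Ω] {P : Measure Ω} {X : Ω → ℝ × ℝ}
    (hX : AEMeasurable X P) (t : WithLp 2 (ℝ × ℝ)) :
    charFun (P.map fun ω => WithLp.toLp 2 (X ω)) t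
      = ∫ ω, Complex.exp ((t.fst * (X ω).1 + t.snd * (X ω).2 : ℝ) * Complex.I) ∂P := by
  have hm : Measurable (WithLp.toLp 2 : ℝ × ℝ → WithLp 2 (ℝ × ℝ)) :=
    (WithLp.prod_continuous_toLp 2 ℝ ℝ).measurable
  have hX' : AEMeasurable (fun ω => WithLp.toLp 2 (X ω)) P := hm.comp_aemeasurable hX
  rw [charFun_apply, integral_map hX' (by fun_prop)]
  simp [WithLp.prod_inner_apply]

lemma tendstoInDistribution_prod_of_tendsto_integral_exp
    {Ω : ℕ → Type*} [∀ n, MeasurableSpace (Ω n)] {Ω' : Type*} [MeasurableSpace Ω']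
    {P : ∀ n, Measure (Ω n)} [∀ n, IsProbabilityMeasure (P n)]
    {Q : Measure Ω'} [IsProbabilityMeasure Q] {X : ∀ n, Ω n → ℝ × ℝ} {Z : Ω' → ℝ × ℝ}
    (hX : ∀ n, AEMeasurable (X n) (P n)) (hZ : AEMeasurable Z Q)
    (h : ∀ s t : ℝ, Tendsto
      (fun n => ∫ ω, Complex.exp ((s * (X n ω).1 + t * (X n ω).2 : ℝ) * Complex.I) ∂P n) atTop
      (𝓝 (∫ ω, Complex.exp ((s * (Z ω).1 + t * (Z ω).2 : ℝ) * Complex.I) ∂Q))) :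
    TendstoInDistribution X atTop Z P Q := by
  have hm : Measurable (WithLp.toLp 2 : ℝ × ℝ → WithLp 2 (ℝ × ℝ)) :=
    (WithLp.prod_continuous_toLp 2 ℝ ℝ).measurable
  refine TendstoInDistribution.continuous_comp (WithLp.prod_continuous_ofLp 2 ℝ ℝ)
    (X := fun n ω => WithLp.toLp 2 (X n ω)) (Z := fun ω => WithLp.toLp 2 (Z ω)) ?_
  refine tendstoInDistribution_of_tendsto_charFun (fun n => hm.comp_aemeasurable (hX n))
    (hm.comp_aemeasurable hZ) fun t => ?_
  simp only [charFun_map_toLp (hX _), charFun_map_toLp hZ]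
  exact h _ _

lemma integral_exp_add_eq_charFun_mul_charFun {Ω : Type*} [MeasurableSpace Ω] {P : Measure Ω}
    {X Y : Ω → ℝ} {μ ν : Measure ℝ} (hX : HasLaw X μ P) (hY : HasLaw Y ν P)
    (hXY : IndepFun X Y P) (s t : ℝ) :
    ∫ ω, Complex.exp ((s * X ω + t * Y ω : ℝ) * Complex.I) ∂P = charFun μ s * charFun ν t := by
  rw [charFun_apply_real, charFun_apply_real, ← hX.integral_comp (by fun_prop),
    ← hY.integral_comp (by fun_prop),
    ← (hXY.comp (φ := fun x : ℝ => Complex.exp (s * x * Complex.I))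
      (ψ := fun y : ℝ => Complex.exp (t * y * Complex.I)) (by fun_prop)
      (by fun_prop)).integral_fun_mul_eq_mul_integral
      ((by fun_prop : Measurable fun x : ℝ => Complex.exp (s * x * Complex.I)).comp_aemeasurable
        hX.aemeasurable).aestronglyMeasurable
      ((by fun_prop : Measurable fun y : ℝ => Complex.exp (t * y * Complex.I)).comp_aemeasurable
        hY.aemeasurable).aestronglyMeasurable]
  refine integral_congr_ae (ae_of_all _ fun ω => ?_)
  simp only [Function.comp_apply, ← Complex.exp_add]
  push_cast
  ring_nf

section CriticalWindow

variable {γ : ℝ} {β : ℕ → ℝ} (hβ : Tendsto (fun n : ℕ => √n * (1 - β n)) atTop (𝓝 γ))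
  {Ω : ℕ → Type*} [∀ n, MeasurableSpace (Ω n)]
  {P : ∀ n, Measure (Ω n)} [∀ n, IsProbabilityMeasure (P n)]
  {Ω' : Type*} [MeasurableSpace Ω'] {Q : Measure Ω'} [IsProbabilityMeasure Q]

include hβ

lemma tendstoInDistribution_rescaledPair {U : ∀ n, Fin n → Ω n → ℝ} {V : ∀ n, Ω n → ℝ}
    {G F : Ω' → ℝ} (hU : ∀ n k, AEMeasurable (U n k) (P n)) (hV : ∀ n, AEMeasurable (V n) (P n))
    (hUV : ∀ n, 0 < n → 0 < β n → IsUniformCoupling n (β n) (U n) (V n) (P n))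
    (hG : HasLaw G (gaussianReal 0 1) Q) (hF : HasLaw F (limitLaw γ) Q) (hGF : IndepFun G F Q) :
    TendstoInDistribution
      (fun n ω => rescaledPair (fun k => coupledSpin (U n k ω) (V n ω)) (V n ω)) atTop
      (fun ω => (G ω, F ω)) P Q := by
  refine tendstoInDistribution_prod_of_tendsto_integral_exp (fun n => ?_)
    (hG.aemeasurable.prodMk hF.aemeasurable) fun s t => ?_
  · have hpair := ((measurable_rescaledPair n).comp (measurable_coupling n)).comp_aemeasurable
      ((aemeasurable_pi_lambda _ (hU n)).prodMk (hV n))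
    simpa only [Function.comp_def, coupling] using hpair
  have hlim : charFun (gaussianReal 0 1) s = Complex.exp (-(s ^ 2 / 2 : ℝ)) := by
    simp [charFun_gaussianReal]
  simp only [integral_exp_add_eq_charFun_mul_charFun hG hF hGF, hlim]
  refine (tendsto_integral_exp_rescaledPair hβ tendsto_const_nhds t).congr' ?_
  filter_upwards [eventually_pos_of_tendsto_sqrt_mul hβ] with n hn
  rw [← (hUV n hn.1 hn.2).hasLaw_coupledLaw.integral_comp
    (measurable_exp_rescaledPair n s t).aestronglyMeasurable]
  rfl

lemma tendsto_charFun_map_sum_curieWeissMeasure (t : ℝ) :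
    Tendsto (fun n : ℕ => charFun ((curieWeissMeasure n (β n)).map fun x =>
      (∑ k, x k) / (n : ℝ) ^ (3 / 4 : ℝ)) t) atTop (𝓝 (charFun (limitLaw γ) t)) := by
  have h := tendsto_integral_exp_rescaledPair hβ (s := 0)
    (σ := fun n : ℕ => t / (n : ℝ) ^ (1 / 4 : ℝ))
    (tendsto_const_nhds.div_atTop tendsto_natCast_rpow_quarter) t
  simp only [ne_eq, OfNat.ofNat_ne_zero, not_false_eq_true, zero_pow, zero_div, neg_zero,
    Complex.ofReal_zero, Complex.exp_zero, one_mul] at h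
  refine h.congr' ?_
  filter_upwards [eventually_pos_of_tendsto_sqrt_mul hβ] with n hn
  rw [← fst_coupledLaw hn.1 hn.2, Measure.fst, Measure.map_map (by fun_prop) measurable_fst,
    charFun_apply_real, integral_map (by fun_prop) (by fun_prop)]
  refine integral_congr_ae (ae_of_all _ fun q => ?_)
  simp only [Function.comp_apply, ← Complex.ofReal_mul, sum_div_eq_rescaledPair hn.1 q.1 q.2]
  ring_nf

lemma tendstoInDistribution_sum_div {X : ∀ n, Ω n → Fin n → ℝ} {F : Ω' → ℝ}
    (hXm : ∀ n, AEMeasurable (X n) (P n))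
    (hX : ∀ n, 0 < n → 0 < β n → HasLaw (X n) (curieWeissMeasure n (β n)) (P n))
    (hF : HasLaw F (limitLaw γ) Q) :
    TendstoInDistribution (fun (n : ℕ) ω => (∑ k, X n ω k) / (n : ℝ) ^ (3 / 4 : ℝ))
      atTop F P Q := by
  have hmeas (n : ℕ) : Measurable fun x : Fin n → ℝ => (∑ k, x k) / (n : ℝ) ^ (3 / 4 : ℝ) := by
    fun_prop
  refine tendstoInDistribution_of_tendsto_charFun
    (fun n => (hmeas n).comp_aemeasurable (hXm n)) hF.aemeasurable fun t => ?_
  rw [hF.map_eq]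
  refine (tendsto_charFun_map_sum_curieWeissMeasure hβ t).congr' ?_
  filter_upwards [eventually_pos_of_tendsto_sqrt_mul hβ] with n hn
  rw [← (hX n hn.1 hn.2).map_eq, AEMeasurable.map_map_of_aemeasurable (hmeas n).aemeasurable
    (hXm n)]
  rfl

end CriticalWindow

lemma gammaMeasure_eq_tilted {a r : ℝ} (ha : 0 < a) (hr : 0 < r) :
    gammaMeasure a r
      = (volume.restrict (Set.Ioi 0)).tilted fun x => (a - 1) * log x - r * x := by
  have hexp {x : ℝ} (hx : 0 < x) :
      exp ((a - 1) * log x - r * x) = x ^ (a - 1) * exp (-(r * x)) := by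
    rw [rpow_def_of_pos hx, ← exp_add, mul_comm (log x), sub_eq_add_neg]
  have hnorm : ∫ x in Set.Ioi 0, exp ((a - 1) * log x - r * x) = (1 / r) ^ a * Gamma a := by
    rw [← integral_rpow_mul_exp_neg_mul_Ioi ha hr]
    exact setIntegral_congr_fun measurableSet_Ioi fun x hx => hexp hx
  rw [Measure.tilted, ← withDensity_indicator measurableSet_Ioi, gammaMeasure]
  refine withDensity_congr_ae ?_
  filter_upwards [Measure.ae_ne volume 0] with x hx
  rcases lt_or_gt_of_ne hx with hx | hx
  · rw [gammaPDF_of_neg hx, Set.indicator_of_notMem (Set.notMem_Ioi.2 hx.le)]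
  · rw [gammaPDF_of_nonneg hx.le, Set.indicator_of_mem (Set.mem_Ioi.2 hx), hnorm, hexp hx,
      one_div, inv_rpow hr.le]
    congr 1
    field_simp

lemma map_rpow_gammaMeasure {p c : ℝ} (hp : 0 < p) (hc : 0 < c) :
    (gammaMeasure (1 / p) 1).map (fun x => (c * x) ^ (1 / p))
      = (volume.restrict (Set.Ioi 0)).tilted fun x => -(x ^ p / c) := by
  have hroot {x : ℝ} (hx : 0 < x) : ((c * x) ^ (1 / p)) ^ p = c * x := by
    rw [one_div, rpow_inv_rpow (by positivity) hp.ne']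
  have himage : (fun x => (c * x) ^ (1 / p)) '' Set.Ioi 0 = Set.Ioi 0 := by
    refine Set.Subset.antisymm (Set.image_subset_iff.2 fun x (hx : 0 < x) => ?_)
      fun y (hy : 0 < y) => ⟨y ^ p / c, by simp only [Set.mem_Ioi]; positivity, ?_⟩
    · simp only [Set.mem_preimage, Set.mem_Ioi]
      positivity
    · simp only [mul_div_cancel₀ _ hc.ne', one_div, rpow_rpow_inv hy.le hp.ne']
  have hderiv (x : ℝ) (hx : 0 < x) : HasDerivWithinAt (fun x => (c * x) ^ (1 / p))
      (c * (1 / p) * (c * x) ^ (1 / p - 1)) (Set.Ioi 0) x :=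
    ((hasDerivAt_const_mul c).rpow_const (Or.inl (by positivity))).hasDerivWithinAt
  rw [gammaMeasure_eq_tilted (by positivity) one_pos, map_tilted_restrict measurableSet_Ioi
    (by fun_prop) ?_ hderiv (by positivity : 0 < c * (1 / p) * c ^ (1 / p - 1)) ?_, himage]
  · intro x (hx : 0 < x) y (hy : 0 < y) hxy
    have h := congrArg (· ^ p) hxy
    simp only [hroot hx, hroot hy] at h
    exact mul_left_cancel₀ hc.ne' h
  · intro x (hx : 0 < x)
    rw [hroot hx, mul_div_cancel_left₀ _ hc.ne', abs_of_pos (by positivity),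
      mul_rpow hc.le hx.le, sub_eq_add_neg ((1 / p - 1) * log x), exp_add, one_mul,
      mul_comm (1 / p - 1) (log x), ← rpow_def_of_pos hx]
    ring

lemma map_neg_tilted_restrict_Ioi {h : ℝ → ℝ} (hh : Function.Even h) :
    ((volume.restrict (Set.Ioi 0)).tilted h).map (fun x => -x)
      = (volume.restrict (Set.Iio 0)).tilted h := by
  rw [map_tilted_restrict (g := h) measurableSet_Ioi measurable_neg neg_injective.injOn
    (fun x _ => (hasDerivAt_neg' x).hasDerivWithinAt) one_pos fun x _ => by simp [hh x],
    Set.image_neg_Ioi, neg_zero]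

lemma tilted_eq_half_of_even {h : ℝ → ℝ} (hh : Function.Even h) :
    (volume : Measure ℝ).tilted h = (2⁻¹ : ENNReal) • ((volume.restrict (Set.Ioi 0)).tilted h
      + (volume.restrict (Set.Iio 0)).tilted h) := by
  have hneg : ∫ x in Set.Iio 0, exp (h x) = ∫ x in Set.Ioi 0, exp (h x) := by
    have hcomp := integral_comp_neg_Ioi (0 : ℝ) fun x => exp (h x)
    rw [neg_zero, integral_Iic_eq_integral_Iio] at hcomp
    simp only [← hcomp, hh _]
  have hnorm : ∫ x, exp (h x) = 2 * ∫ x in Set.Ioi 0, exp (h x) := by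
    rw [← integral_comp_abs (f := fun x => exp (h x))]
    exact integral_congr_ae (ae_of_all _ fun x => by
      rcases abs_choice x with hx | hx <;> simp only [hx, hh x])
  have hdensity : (fun x => ENNReal.ofReal (exp (h x) / ∫ y, exp (h y)))
      = (2⁻¹ : ENNReal) • fun x => ENNReal.ofReal (exp (h x) / ∫ y in Set.Ioi 0, exp (h y)) := by
    ext x
    rw [Pi.smul_apply, smul_eq_mul, hnorm, mul_comm (2 : ℝ), ← div_div, div_eq_inv_mul _ (2 : ℝ),
      ENNReal.ofReal_mul (by norm_num), ENNReal.ofReal_inv_of_pos two_pos, ENNReal.ofReal_ofNat]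
  have hsplit : volume.restrict (Set.Ioi (0 : ℝ)) + volume.restrict (Set.Iio 0) = volume := by
    rw [restrict_Iio_eq_restrict_Iic, ← Set.compl_Ioi,
      Measure.restrict_add_restrict_compl measurableSet_Ioi]
  rw [Measure.tilted, Measure.tilted, Measure.tilted, hneg, ← withDensity_add_measure, hsplit,
    hdensity, withDensity_smul' _ _ (by simp)]

lemma map_mul_spinLaw_prod (ν : Measure ℝ) [SFinite ν] :
    (spinLaw.prod ν).map (fun q => q.1 * q.2)
      = (2⁻¹ : ENNReal) • (ν + ν.map fun x => -x) := by
  have hspin : spinLaw = (2⁻¹ : ENNReal) • (Measure.dirac 1 + Measure.dirac (-1)) := by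
    have hweight {q : NNReal} (hq : (q : ℝ) = 1 / 2) (ν : Measure ℝ) :
        q • ν = (2⁻¹ : ENNReal) • ν := by
      rw [show q = 2⁻¹ from NNReal.eq (by simpa using hq), ENNReal.smul_def,
        ENNReal.coe_inv two_ne_zero, ENNReal.coe_ofNat]
    rw [spinLaw, bernoulliMeasure_def, hweight rfl, hweight (by simp; norm_num), smul_add]
  rw [hspin, Measure.prod_smul_left, Measure.add_prod, Measure.dirac_prod, Measure.dirac_prod,
    Measure.map_smul, Measure.map_add _ _ (by fun_prop),
    Measure.map_map (by fun_prop) (by fun_prop), Measure.map_map (by fun_prop) (by fun_prop)]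
  simp [Function.comp_def]

lemma hasLaw_mul_of_spinLaw {Ω : Type*} [MeasurableSpace Ω] {P : Measure Ω} [IsFiniteMeasure P]
    {B R : Ω → ℝ} {h : ℝ → ℝ} (hh : Function.Even h) (hB : HasLaw B spinLaw P)
    (hR : HasLaw R ((volume.restrict (Set.Ioi 0)).tilted h) P) (hBR : IndepFun B R P) :
    HasLaw (fun ω => B ω * R ω) ((volume : Measure ℝ).tilted h) P :=
  HasLaw.comp (Y := fun q : ℝ × ℝ => q.1 * q.2) ⟨by fun_prop, by
    rw [map_mul_spinLaw_prod, map_neg_tilted_restrict_Ioi hh, ← tilted_eq_half_of_even hh]⟩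
    (hBR.hasLaw_prod hB hR)

lemma integral_exp_neg_mul_abs_rpow {p b : ℝ} (hp : 0 < p) (hb : 0 < b) :
    ∫ x : ℝ, exp (-b * |x| ^ p) = 2 * (b ^ (-1 / p) * Gamma (1 / p + 1)) := by
  rw [integral_comp_abs (f := fun x => exp (-b * x ^ p)), integral_exp_neg_mul_rpow hp hb]

lemma integral_exp_neg_quartic :
    ∫ x : ℝ, exp (-(x ^ 4 / 12)) = 3 ^ (1 / 4 : ℝ) * 2 ^ (-(1 / 2) : ℝ) * Gamma (1 / 4) := by
  have hquartic (x : ℝ) : -(x ^ 4 / 12) = -(1 / 12) * |x| ^ (4 : ℝ) := by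
    rw [rpow_ofNat, Even.pow_abs (by decide)]
    ring
  have htwelve : (1 / 12 : ℝ) ^ (-1 / 4 : ℝ) = 3 ^ (1 / 4 : ℝ) * 2 ^ (1 / 2 : ℝ) := by
    rw [one_div, inv_rpow (by norm_num), ← rpow_neg (by norm_num),
      show (12 : ℝ) = 3 * 2 ^ (2 : ℝ) by norm_num, mul_rpow (by norm_num) (by norm_num),
      ← rpow_mul (by norm_num)]
    norm_num
  have htwo : (2 : ℝ) ^ (1 / 2 : ℝ) = 2 * 2 ^ (-(1 / 2) : ℝ) := by
    rw [show (1 / 2 : ℝ) = 1 + -(1 / 2) by norm_num, rpow_add (by norm_num), rpow_one]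
    norm_num
  simp only [hquartic]
  rw [integral_exp_neg_mul_abs_rpow (by norm_num) (by norm_num), htwelve, htwo,
    Gamma_add_one (by norm_num)]
  ring

lemma hasLaw_mul_rpow_of_gammaMeasure {Ω : Type*} [MeasurableSpace Ω] {P : Measure Ω}
    [IsFiniteMeasure P] {B g : Ω → ℝ} {p c : ℝ} (hp : 0 < p) (hc : 0 < c)
    (hB : HasLaw B spinLaw P) (hg : HasLaw g (gammaMeasure (1 / p) 1) P) (hBg : IndepFun B g P) :
    HasLaw (fun ω => B ω * (c * g ω) ^ (1 / p))
      ((volume : Measure ℝ).tilted fun x => -(|x| ^ p / c)) P := by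
  have hpos : (volume.restrict (Set.Ioi 0)).tilted (fun x : ℝ => -(x ^ p / c))
      = (volume.restrict (Set.Ioi 0)).tilted fun x : ℝ => -(|x| ^ p / c) :=
    tilted_congr <| by
      filter_upwards [ae_restrict_mem measurableSet_Ioi] with x (hx : 0 < x)
      rw [abs_of_pos hx]
  have hroot : HasLaw (fun x => (c * x) ^ (1 / p))
      ((volume.restrict (Set.Ioi 0)).tilted fun x => -(|x| ^ p / c)) (gammaMeasure (1 / p) 1) :=
    ⟨by fun_prop, by rw [map_rpow_gammaMeasure hp hc, hpos]⟩
  exact hasLaw_mul_of_spinLaw (fun x => by rw [abs_neg]) hB (hroot.comp hg)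
    (hBg.comp (φ := id) (ψ := fun x => (c * x) ^ (1 / p)) measurable_id (by fun_prop))

lemma limitLaw_zero : limitLaw 0 = (volume : Measure ℝ).tilted fun x => -(|x| ^ (4 : ℝ) / 12) := by
  simp only [limitLaw, rpow_ofNat, Even.pow_abs (show Even 4 by decide), zero_mul, sub_zero]

end CurieWeiss

end

theorem mainTheorem4_general (γ : ℝ) (β : ℕ → ℝ)
    (hβ : Tendsto (fun n : ℕ => √(n : ℝ) * (1 - β n)) atTop (nhds γ)) :
    (IsProbabilityMeasure (CurieWeiss.limitLaw γ) ∧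
      (∀ (n : ℕ) (b : ℝ), IsProbabilityMeasure (CurieWeiss.curieWeissMeasure n b)) ∧
      (∀ (n : ℕ) (b : ℝ), 0 < n → 0 < b →
        IsProbabilityMeasure (CurieWeiss.deFinettiMeasure n b))) ∧
    (∀ (Ω : ℕ → Type*) [∀ n, MeasurableSpace (Ω n)] (P : ∀ n, Measure (Ω n))
        [∀ n, IsProbabilityMeasure (P n)] (X : ∀ n, Ω n → Fin n → ℝ)
        (Ω' : Type*) [MeasurableSpace Ω'] (Q : Measure Ω') [IsProbabilityMeasure Q] (F : Ω' → ℝ),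
        (∀ n, AEMeasurable (X n) (P n)) →
        (∀ n, 0 < n → 0 < β n → HasLaw (X n) (CurieWeiss.curieWeissMeasure n (β n)) (P n)) →
        HasLaw F (CurieWeiss.limitLaw γ) Q →
        TendstoInDistribution (fun (n : ℕ) ω => (∑ k, X n ω k) / (n : ℝ) ^ (3 / 4 : ℝ))
          atTop F P Q) ∧
    (∀ (n : ℕ) (b : ℝ) (Ω : Type*) [MeasurableSpace Ω] (P : Measure Ω) [IsProbabilityMeasure P]
        (U : Fin n → Ω → ℝ) (V : Ω → ℝ),
        0 < n → 0 < b → CurieWeiss.IsUniformCoupling n b U V P →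
        HasLaw (fun ω k => CurieWeiss.coupledSpin (U k ω) (V ω))
          (CurieWeiss.curieWeissMeasure n b) P) ∧
    (∀ (Ω : ℕ → Type*) [∀ n, MeasurableSpace (Ω n)] (P : ∀ n, Measure (Ω n))
        [∀ n, IsProbabilityMeasure (P n)] (U : ∀ n, Fin n → Ω n → ℝ) (V M T : ∀ n, Ω n → ℝ)
        (Ω' : Type*) [MeasurableSpace Ω'] (Q : Measure Ω') [IsProbabilityMeasure Q]
        (G F : Ω' → ℝ),
        (∀ n k, AEMeasurable (U n k) (P n)) → (∀ n, AEMeasurable (V n) (P n)) →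
        (∀ n, 0 < n → 0 < β n → CurieWeiss.IsUniformCoupling n (β n) (U n) (V n) (P n)) →
        (∀ n ω, M n ω = ∑ k, CurieWeiss.coupledSpin (U n k ω) (V n ω)) →
        (∀ n ω, T n ω = 2 * V n ω - 1) →
        HasLaw G (gaussianReal 0 1) Q → HasLaw F (CurieWeiss.limitLaw γ) Q → IndepFun G F Q →
        TendstoInDistribution
          (fun (n : ℕ) ω =>
            ((n : ℝ) ^ (1 / 4 : ℝ) *
                (M n ω / (n : ℝ) ^ (3 / 4 : ℝ) - (n : ℝ) ^ (1 / 4 : ℝ) * T n ω),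
              (n : ℝ) ^ (1 / 4 : ℝ) * T n ω))
          atTop (fun ω => (G ω, F ω)) P Q) ∧
    ((∫ x : ℝ, Real.exp (-(x ^ 4 / 12)))
        = (3 : ℝ) ^ (1 / 4 : ℝ) * (2 : ℝ) ^ (-(1 / 2) : ℝ) * Real.Gamma (1 / 4)) ∧
    (∀ (Ω : Type*) [MeasurableSpace Ω] (P : Measure Ω) [IsProbabilityMeasure P]
        (B g : Ω → ℝ),
        HasLaw B CurieWeiss.spinLaw P → HasLaw g (gammaMeasure (1 / 4) 1) P → IndepFun B g P →
        HasLaw (fun ω => B ω * (12 * g ω) ^ (1 / 4 : ℝ)) (CurieWeiss.limitLaw 0) P) := by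
  refine ⟨⟨inferInstance, inferInstance, fun n b hn hb =>
    CurieWeiss.isProbabilityMeasure_deFinettiMeasure hn hb⟩, ?_, ?_, ?_,
    CurieWeiss.integral_exp_neg_quartic, ?_⟩
  · intro Ω _ P _ X Ω' _ Q _ F hXm hX hF
    exact CurieWeiss.tendstoInDistribution_sum_div hβ hXm hX hF
  · intro n b Ω _ P _ U V hn hb hUV
    exact hUV.hasLaw_coupledSpin hn hb
  · intro Ω _ P _ U V M T Ω' _ Q _ G F hU hV hUV hM hT hG hF hGF
    simp only [hM, hT]
    exact CurieWeiss.tendstoInDistribution_rescaledPair hβ hU hV hUV hG hF hGF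
  · intro Ω _ P _ B g hB hg hBg
    rw [CurieWeiss.limitLaw_zero]
    exact CurieWeiss.hasLaw_mul_rpow_of_gammaMeasure (by norm_num) (by norm_num) hB hg hBg

theorem mainTheorem4 (γ : ℝ) (β : ℕ → ℝ) (hβ : ∀ n : ℕ, 0 < n → β n = 1 - γ / √(n : ℝ)) :
    -- all the laws involved are probability measures
    (IsProbabilityMeasure (CurieWeiss.limitLaw γ) ∧
      (∀ (n : ℕ) (b : ℝ), IsProbabilityMeasure (CurieWeiss.curieWeissMeasure n b)) ∧
      (∀ (n : ℕ) (b : ℝ), 0 < n → 0 < b →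
        IsProbabilityMeasure (CurieWeiss.deFinettiMeasure n b))) ∧
    -- convergence of the rescaled magnetisation of Curie-Weiss spins `X n` at inverse temperature `β n`
    (∀ (Ω : ℕ → Type*) [∀ n, MeasurableSpace (Ω n)] (P : ∀ n, Measure (Ω n))
        [∀ n, IsProbabilityMeasure (P n)] (X : ∀ n, Ω n → Fin n → ℝ)
        (Ω' : Type*) [MeasurableSpace Ω'] (Q : Measure Ω') [IsProbabilityMeasure Q] (F : Ω' → ℝ),
        (∀ n, AEMeasurable (X n) (P n)) →
        (∀ n, 0 < n → 0 < β n → HasLaw (X n) (CurieWeiss.curieWeissMeasure n (β n)) (P n)) →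
        HasLaw F (CurieWeiss.limitLaw γ) Q →
        TendstoInDistribution (fun (n : ℕ) ω => (∑ k, X n ω k) / (n : ℝ) ^ (3 / 4 : ℝ)) atTop F P Q) ∧
    -- the spins `2 · 1_{U k < V} - 1` are Curie-Weiss spins
    (∀ (n : ℕ) (b : ℝ) (Ω : Type*) [MeasurableSpace Ω] (P : Measure Ω) [IsProbabilityMeasure P]
        (U : Fin n → Ω → ℝ) (V : Ω → ℝ),
        0 < n → 0 < b → CurieWeiss.IsUniformCoupling n b U V P →
        HasLaw (fun ω k => CurieWeiss.coupledSpin (U k ω) (V ω))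
          (CurieWeiss.curieWeissMeasure n b) P) ∧
    -- joint convergence, with `T n = 2 * V n - 1`
    (∀ (Ω : ℕ → Type*) [∀ n, MeasurableSpace (Ω n)] (P : ∀ n, Measure (Ω n))
        [∀ n, IsProbabilityMeasure (P n)] (U : ∀ n, Fin n → Ω n → ℝ) (V M T : ∀ n, Ω n → ℝ)
        (Ω' : Type*) [MeasurableSpace Ω'] (Q : Measure Ω') [IsProbabilityMeasure Q]
        (G F : Ω' → ℝ),
        (∀ n k, AEMeasurable (U n k) (P n)) → (∀ n, AEMeasurable (V n) (P n)) →
        (∀ n, 0 < n → 0 < β n → CurieWeiss.IsUniformCoupling n (β n) (U n) (V n) (P n)) →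
        (∀ n ω, M n ω = ∑ k, CurieWeiss.coupledSpin (U n k ω) (V n ω)) →
        (∀ n ω, T n ω = 2 * V n ω - 1) →
        HasLaw G (gaussianReal 0 1) Q → HasLaw F (CurieWeiss.limitLaw γ) Q → IndepFun G F Q →
        TendstoInDistribution
          (fun (n : ℕ) ω =>
            ((n : ℝ) ^ (1 / 4 : ℝ) *
                (M n ω / (n : ℝ) ^ (3 / 4 : ℝ) - (n : ℝ) ^ (1 / 4 : ℝ) * T n ω),
              (n : ℝ) ^ (1 / 4 : ℝ) * T n ω))
          atTop (fun ω => (G ω, F ω)) P Q) ∧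
    -- the limit law for `γ = 0`: its normalising constant and its representation in law
    ((∫ x : ℝ, Real.exp (-(x ^ 4 / 12)))
        = (3 : ℝ) ^ (1 / 4 : ℝ) * (2 : ℝ) ^ (-(1 / 2) : ℝ) * Real.Gamma (1 / 4)) ∧
    (∀ (Ω : Type*) [MeasurableSpace Ω] (P : Measure Ω) [IsProbabilityMeasure P]
        (B g : Ω → ℝ),
        HasLaw B CurieWeiss.spinLaw P → HasLaw g (gammaMeasure (1 / 4) 1) P → IndepFun B g P →
        HasLaw (fun ω => B ω * (12 * g ω) ^ (1 / 4 : ℝ)) (CurieWeiss.limitLaw 0) P) := by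
  refine mainTheorem4_general γ β (tendsto_const_nhds.congr' ?_)
  filter_upwards [eventually_gt_atTop 0] with n hn
  rw [hβ n hn, sub_sub_cancel, mul_div_cancel₀ _ (by positivity)]
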